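/- Let $D\subset\mathbb{R}^2$ be a closed disk in the plane with symplectic coordinates $(p,q)$, i.e. the image of the closed unit disk under a $C^2$-diffeomorphism between open subsets of the plane, and let $h\colon D\to D$ be a symplectic ($C^1$, with $h^*(dp\wedge dq)=dp\wedge dq$) map that sends the boundary $\partial D$ to itself. Let $H_1(p,q,t)$ and $H_2(p,q,t)$ be functions on $\mathbb{R}^2\times\mathbb{R}$, $2\pi$-periodic in $t$ and $C^2$ in $(p,q)$, which are jointly continuous in $(p,q,t)$ together with their first and second derivatives in $(p,q)$. Suppose that $D$ is invariant under each of the Hamiltonian systems $$\dot p=-\frac{\partial H_i}{\partial q},\qquad \dot q=\frac{\partial H_i}{\partial p}\qquad(i=1,2),$$ meaning that for every initial time $s\in\mathbb{R}$ and every point of $D$ there is a solution through that point at time $s$ that exists and stays in $D$ for all times. Let $g^t_{H_i}$ denote the flow on $D$ from time $0$ to time $t$, and suppose that $g^{2\pi}_{H_1}=g^{2\pi}_{H_2}=h$ on $D$. Then for each $i$ there is a unique function $\tilde H_i$ that differs from $H_i$ by a function of $t$ only and vanishes on $\partial D\times\mathbb{R}$, and the helicities $$\mathcal{H}(H_i)=\int_0^{2\pi}\int_D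 \tilde H_i(p,q,t)\,dp\wedge dq\wedge dt$$ satisfy $$\mathcal{H}(H_1)-\mathcal{H}(H_2)=\frac{n\,S(D)^2}{2}\qquad\text{for some } n\in\mathbb{Z},$$ where $S(D)=\int_D dp\wedge dq$ is the symplectic area of $D$. -/

import Mathlib

open Set MeasureTheory

/-- The closed unit disk of the plane `ℝ²` with coordinates `(p, q)` (Euclidean, not sup norm). -/
def closedUnitDisk : Set (ℝ × ℝ) := {x | x.1 ^ 2 + x.2 ^ 2 ≤ 1}

/-- A (smoothly embedded, closed) disk in the plane: the image of the closed unit disk under a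
`C²`-diffeomorphism between open subsets of the plane. -/
def IsDisk (D : Set (ℝ × ℝ)) : Prop :=
  ∃ Φ : OpenPartialHomeomorph (ℝ × ℝ) (ℝ × ℝ),
    closedUnitDisk ⊆ Φ.source ∧
    ContDiffOn ℝ 2 Φ Φ.source ∧
    ContDiffOn ℝ 2 Φ.symm Φ.target ∧
    D = Φ '' closedUnitDisk

/-- The standard symplectic form `dp ∧ dq`. -/
def omegaForm (u v : ℝ × ℝ) : ℝ := u.1 * v.2 - u.2 * v.1

/-- A symplectic map of `D` to itself: a `C¹` map `h : D → D` with `h^*(dp ∧ dq) = dp ∧ dq`. -/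
structure IsSymplecticMap (D : Set (ℝ × ℝ)) (h : ℝ × ℝ → ℝ × ℝ) : Prop where
  mapsTo : MapsTo h D D
  contDiffOn : ContDiffOn ℝ 1 h D
  pullback : ∀ x ∈ D, ∀ u v : ℝ × ℝ,
    omegaForm (fderivWithin ℝ h D x u) (fderivWithin ℝ h D x v) = omegaForm u v

/-- A `2π`-periodic time-dependent Hamiltonian `H t (p, q)`: twice continuously differentiable in
`(p, q)`, with `H` and its first and second derivatives in `(p, q)` jointly continuous in
`(t, (p, q))`. -/
structure IsPeriodicHamiltonian (H : ℝ → ℝ × ℝ → ℝ) : Prop where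
  periodic : ∀ t x, H (t + 2 * Real.pi) x = H t x
  contDiff : ∀ t, ContDiff ℝ 2 (H t)
  continuous : Continuous fun z : ℝ × (ℝ × ℝ) => H z.1 z.2
  continuous_fderiv : Continuous fun z : ℝ × (ℝ × ℝ) => fderiv ℝ (H z.1) z.2
  continuous_fderiv_fderiv :
    Continuous fun z : ℝ × (ℝ × ℝ) => fderiv ℝ (fderiv ℝ (H z.1)) z.2

/-- The Hamiltonian vector field `(-∂H/∂q, ∂H/∂p)` at time `t`. -/
noncomputable def hamVectorField (H : ℝ → ℝ × ℝ → ℝ) (t : ℝ) (x : ℝ × ℝ) : ℝ × ℝ :=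
  (-(fderiv ℝ (H t) x (0, 1)), fderiv ℝ (H t) x (1, 0))

/-- `γ` is a solution, defined for all times, of `p' = -∂H/∂q`, `q' = ∂H/∂p`. -/
def IsHamSolution (H : ℝ → ℝ × ℝ → ℝ) (γ : ℝ → ℝ × ℝ) : Prop :=
  ∀ t, HasDerivAt γ (hamVectorField H t (γ t)) t

/-- `D` is invariant for the Hamiltonian system: through each point of `D`, at each
initial time `s`, passes a solution that exists and stays in `D` for all times. -/
def IsInvariantSet (D : Set (ℝ × ℝ)) (H : ℝ → ℝ × ℝ → ℝ) : Prop :=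
  ∀ s, ∀ x ∈ D, ∃ γ : ℝ → ℝ × ℝ, IsHamSolution H γ ∧ γ s = x ∧ ∀ t, γ t ∈ D

/-- `g t` is, on `D`, the flow of the Hamiltonian system from time `0` to time `t`. -/
def IsHamFlow (D : Set (ℝ × ℝ)) (H : ℝ → ℝ × ℝ → ℝ) (g : ℝ → ℝ × ℝ → ℝ × ℝ) : Prop :=
  ∀ x ∈ D, g 0 x = x ∧ IsHamSolution H fun t => g t x

/-- `K` is the normalisation of `H`: it differs from `H` by a term that
depends on time only, and it vanishes on `∂D` at all times. -/
def IsNormalisation (D : Set (ℝ × ℝ)) (H K : ℝ → ℝ × ℝ → ℝ) : Prop :=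
  (∃ c : ℝ → ℝ, ∀ t x, K t x = H t x + c t) ∧ ∀ t, ∀ x ∈ frontier D, K t x = 0

/-- The integral `∫₀^{2π} ∫_D K dp ∧ dq ∧ dt`; it is the helicity of `H` when `K` is the
normalisation of `H`. -/
noncomputable def helicityIntegral (D : Set (ℝ × ℝ)) (K : ℝ → ℝ × ℝ → ℝ) : ℝ :=
  ∫ t in (0 : ℝ)..(2 * Real.pi), ∫ x in D, K t x

/-- The symplectic area `∫_D dp ∧ dq`. -/
noncomputable def symplecticArea (D : Set (ℝ × ℝ)) : ℝ := (volume D).toReal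

/-! Follow two distinct points `x`, `y` of `D` along a Hamiltonian flow. Their difference never
vanishes, so it turns by a well-defined total angle during `[0, 2π]` (`pairRotation`). The theorem
comes from evaluating the integral of this angle over `D × D` in two ways.

Topologically: the two flows share their time-`2π` map, so for each pair the difference vector has
the same initial and the same final value under both. The two angles therefore differ by `2π` times
an integer (`exists_int_pairRotation_sub`). This integer is continuous in the pair, and the pairs of
distinct points of an open disk form a connected space, so it is a constant `n`
(`exists_int_eq_of_continuousOn`). The diagonal and the boundary are null sets, so the integrated
angles differ by `2πn S(D)²`.

Analytically: the angular velocity of a pair is the bounded kernel `pairKernel`. By Liouville's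
theorem (`setIntegral_comp`), its integral over moving pairs equals its integral over fixed pairs.
There it is the sum of `dK_x(x - y) / |x - y|²` and the same term with `x` and `y` exchanged, where
`K` is the normalised Hamiltonian. Since `K` vanishes on `∂D`, integrating along rays from `y` shows
that the first term integrates over `x` to `-2π K(y)` (`setIntegral_fderiv_div_normSqPlane`). The
integrated angle is thus `-4π` times the helicity, and comparing the two values gives a difference
of helicities `-n S(D)² / 2`.

The normalisation exists because trajectories confined to `D` force the field to be tangent to `∂D`,
so the Hamiltonian is constant there (`eq_on_image_unitCircle`). -/

/-! ### Time-dependent C¹ fields and uniqueness of solutions -/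

/-- A time-dependent vector field that is `C¹` in space, jointly continuous with its derivative. -/
structure IsC1Field {E : Type*} [NormedAddCommGroup E] [NormedSpace ℝ E]
    (X : ℝ → E → E) (A : ℝ → E → E →L[ℝ] E) : Prop where
  hasFDerivAt : ∀ t x, HasFDerivAt (X t) (A t x) x
  continuous : Continuous fun z : ℝ × E => X z.1 z.2
  continuous_fderiv : Continuous fun z : ℝ × E => A z.1 z.2

namespace IsC1Field

variable {E : Type*} [NormedAddCommGroup E] [NormedSpace ℝ E] [ProperSpace E]
  {X : ℝ → E → E} {A : ℝ → E → E →L[ℝ] E}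

theorem exists_bound (hX : IsC1Field X A) (a b R : ℝ) :
    ∃ C : NNReal, ∀ t ∈ Icc a b, ∀ x ∈ Metric.closedBall (0 : E) R, ‖A t x‖ ≤ C := by
  have hc : IsCompact (Icc a b ×ˢ Metric.closedBall (0 : E) R) :=
    isCompact_Icc.prod (isCompact_closedBall _ _)
  obtain ⟨C, hC⟩ := hc.exists_bound_of_continuousOn hX.continuous_fderiv.continuousOn
  exact ⟨C.toNNReal, fun t ht x hx => (hC (t, x) ⟨ht, hx⟩).trans (Real.le_coe_toNNReal C)⟩

theorem exists_lipschitzOnWith (hX : IsC1Field X A) (a b R : ℝ) :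
    ∃ C : NNReal, ∀ t ∈ Icc a b, LipschitzOnWith C (X t) (Metric.closedBall (0 : E) R) := by
  obtain ⟨C, hC⟩ := hX.exists_bound a b R
  refine ⟨C, fun t ht => ?_⟩
  exact (convex_closedBall (0 : E) R).lipschitzOnWith_of_nnnorm_hasFDerivWithin_le
    (fun x _ => (hX.hasFDerivAt t x).hasFDerivWithinAt) (fun x hx => hC t ht x hx)

theorem solution_unique (hX : IsC1Field X A) {γ δ : ℝ → E}
    (hγ : ∀ t, HasDerivAt γ (X t (γ t)) t) (hδ : ∀ t, HasDerivAt δ (X t (δ t)) t) {s : ℝ}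
    (h : γ s = δ s) : γ = δ := by
  ext t
  obtain ⟨a, b, ht, hs⟩ : ∃ a b, t ∈ Ioo a b ∧ s ∈ Ioo a b := by
    use (min (-|t|) (-|s|) - 1), (max |t| |s| + 1)
    grind
  have hγc : Continuous γ := continuous_iff_continuousAt.2 fun t => (hγ t).continuousAt
  have hδc : Continuous δ := continuous_iff_continuousAt.2 fun t => (hδ t).continuousAt
  obtain ⟨R₁, hR₁⟩ := isCompact_Icc.exists_bound_of_continuousOn (s := Icc a b) hγc.continuousOn
  obtain ⟨R₂, hR₂⟩ := isCompact_Icc.exists_bound_of_continuousOn (s := Icc a b) hδc.continuousOn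
  obtain ⟨C, hC⟩ := hX.exists_lipschitzOnWith a b (max R₁ R₂)
  refine ODE_solution_unique_of_mem_Ioo (v := X) (s := fun _ => Metric.closedBall 0 (max R₁ R₂))
    (fun t ht => hC t (Ioo_subset_Icc_self ht)) hs (fun t ht => ⟨hγ t, ?_⟩)
    (fun t ht => ⟨hδ t, ?_⟩) h ht
  · simpa using Or.inl (hR₁ t (Ioo_subset_Icc_self ht))
  · simpa using Or.inr (hR₂ t (Ioo_subset_Icc_self ht))

end IsC1Field

/-! ### Linear differential equations in the plane -/

/-- Coordinatewise truncation of the plane to the square `[-R, R]²`. -/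
noncomputable def clampSquare (R : ℝ) (x : ℝ × ℝ) : ℝ × ℝ :=
  (max (-R) (min R x.1), max (-R) (min R x.2))

theorem lipschitzWith_clampSquare (R : ℝ) : LipschitzWith 1 (clampSquare R) := by
  have h : LipschitzWith 1 fun s : ℝ => max (-R) (min R s) :=
    (LipschitzWith.id.const_min R).const_max (-R)
  have := (h.comp LipschitzWith.prod_fst).prodMk (h.comp LipschitzWith.prod_snd)
  rwa [max_self, mul_one] at this

theorem norm_clampSquare_le {R : ℝ} (hR : 0 ≤ R) (x : ℝ × ℝ) : ‖clampSquare R x‖ ≤ R := by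
  simp only [clampSquare, Prod.norm_def, Real.norm_eq_abs, sup_le_iff, abs_le]
  grind

theorem norm_clampSquare_le_norm {R : ℝ} (hR : 0 ≤ R) (x : ℝ × ℝ) : ‖clampSquare R x‖ ≤ ‖x‖ := by
  have h0 : clampSquare R 0 = 0 := by simp [clampSquare, hR]
  simpa [h0] using (lipschitzWith_clampSquare R).dist_le_mul x 0

theorem clampSquare_eq_self {R : ℝ} {x : ℝ × ℝ} (hx : ‖x‖ ≤ R) : clampSquare R x = x := by
  simp only [Prod.norm_def, Real.norm_eq_abs, sup_le_iff, abs_le] at hx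
  ext <;> simp only [clampSquare] <;> grind

/-- Global existence for a linear equation in the plane. -/
theorem exists_solution_linear {B : ℝ → ℝ × ℝ →L[ℝ] ℝ × ℝ} {T : ℝ} (hT : 0 ≤ T)
    (hB : ContinuousOn B (Icc 0 T)) (u₀ : ℝ × ℝ) :
    ∃ u : ℝ → ℝ × ℝ, u 0 = u₀ ∧ ∀ t ∈ Icc 0 T, HasDerivWithinAt u (B t (u t)) (Icc 0 T) t := by
  obtain ⟨C', hC'⟩ := isCompact_Icc.exists_bound_of_continuousOn hB
  set C : NNReal := C'.toNNReal
  have hC : ∀ t ∈ Icc 0 T, ‖B t‖ ≤ C := fun t ht => (hC' t ht).trans (Real.le_coe_toNNReal _)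
  -- `R` is the Gronwall a priori bound for solutions of the linear equation. Truncating the
  -- argument at `R` bounds the field by `C * R`, so Picard–Lindelöf reaches the whole interval; the
  -- truncated solution then obeys the same a priori bound and never feels the truncation.
  set R : NNReal := ⟨‖u₀‖ * Real.exp (C * T), by positivity⟩
  have hPL : IsPicardLindelof (fun t x => B t (clampSquare R x)) (tmin := 0) (tmax := T)
      ⟨0, left_mem_Icc.2 hT⟩ u₀ (C * R * T.toNNReal) 0 (C * R) C := by
    refine ⟨fun t ht => ?_, fun x _ => ?_, fun t ht x _ => ?_, ?_⟩
    · have h1 : LipschitzWith C (B t) :=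
        (B t).lipschitz.weaken (NNReal.coe_le_coe.1 (by simpa using hC t ht))
      simpa [Function.comp_def] using
        ((h1.comp (lipschitzWith_clampSquare R)).lipschitzOnWith (s := Metric.closedBall _ _))
    · exact hB.clm_apply continuousOn_const
    · push_cast
      exact (B t).le_of_opNorm_le_of_le (hC t ht) (norm_clampSquare_le R.2 x)
    · simp [hT]
  obtain ⟨u, hu0, hu⟩ := hPL.exists_eq_forall_mem_Icc_hasDerivWithinAt₀
  have hbound : ∀ t ∈ Icc 0 T, ‖u t‖ ≤ R := by
    intro t ht
    have h := norm_le_gronwallBound_of_norm_deriv_right_le (f := u) (δ := ‖u₀‖) (K := C) (ε := 0)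
      (fun t ht => (hu t ht).continuousWithinAt)
      (fun t ht => (hu t (Ico_subset_Icc_self ht)).mono_of_mem_nhdsWithin
        (Icc_mem_nhdsGE_of_mem ht)) (by simp at hu0; simp [hu0])
      (fun t ht => by
        simpa using (B t).le_of_opNorm_le_of_le (hC t (Ico_subset_Icc_self ht))
          (norm_clampSquare_le_norm R.2 (u t))) t ht
    rw [gronwallBound_ε0, sub_zero] at h
    refine h.trans ?_
    change _ ≤ ‖u₀‖ * Real.exp (C * T)
    gcongr
    exact ht.2
  refine ⟨u, hu0, fun t ht => ?_⟩
  have := hu t ht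
  rwa [clampSquare_eq_self (hbound t ht)] at this

/-! ### Flows on a compact invariant set and Liouville's theorem -/

/-- `g` is, on the invariant set `D`, the flow from time `0` of the vector field `X`. -/
structure IsFlowOn {E : Type*} [NormedAddCommGroup E] [NormedSpace ℝ E]
    (D : Set E) (X : ℝ → E → E) (g : ℝ → E → E) : Prop where
  invariant : ∀ s, ∀ x ∈ D, ∃ γ : ℝ → E,
    (∀ t, HasDerivAt γ (X t (γ t)) t) ∧ γ s = x ∧ ∀ t, γ t ∈ D
  map_zero : ∀ x ∈ D, g 0 x = x
  hasDerivAt : ∀ x ∈ D, ∀ t, HasDerivAt (fun t => g t x) (X t (g t x)) t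

namespace IsFlowOn

section

variable {E : Type*} [NormedAddCommGroup E] [NormedSpace ℝ E] [ProperSpace E]
  {D : Set E} {X : ℝ → E → E} {A : ℝ → E → E →L[ℝ] E} {g : ℝ → E → E}

theorem mem (hg : IsFlowOn D X g) (hX : IsC1Field X A) {x : E} (hx : x ∈ D) (t : ℝ) :
    g t x ∈ D := by
  obtain ⟨γ, hγ, h0, hD⟩ := hg.invariant 0 x hx
  have := hX.solution_unique (hg.hasDerivAt x hx) hγ (s := 0) (by rw [h0, hg.map_zero x hx])
  exact (congrFun this t).symm ▸ hD t

theorem injOn (hg : IsFlowOn D X g) (hX : IsC1Field X A) (t : ℝ) : InjOn (g t) D := by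
  intro x hx y hy h
  have := congrFun (hX.solution_unique (hg.hasDerivAt x hx) (hg.hasDerivAt y hy) h) 0
  simpa [hg.map_zero x hx, hg.map_zero y hy] using this

theorem image_eq (hg : IsFlowOn D X g) (hX : IsC1Field X A) (t : ℝ) : g t '' D = D := by
  refine Subset.antisymm (image_subset_iff.2 fun x hx => hg.mem hX hx t) fun y hy => ?_
  obtain ⟨γ, hγ, ht, hD⟩ := hg.invariant t y hy
  refine ⟨γ 0, hD 0, ?_⟩
  have := hX.solution_unique (hg.hasDerivAt _ (hD 0)) hγ (s := 0) (hg.map_zero _ (hD 0))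
  simpa [ht] using congrFun this t

theorem exists_lipschitzOnWith (hg : IsFlowOn D X g) (hX : IsC1Field X A) (hD : IsCompact D)
    (T : ℝ) : ∃ C : NNReal, ∀ t ∈ Icc 0 T, LipschitzOnWith C (g t) D := by
  obtain ⟨R, hR⟩ := hD.isBounded.subset_closedBall 0
  obtain ⟨C, hC⟩ := hX.exists_lipschitzOnWith 0 T R
  refine ⟨⟨Real.exp (C * T), by positivity⟩, fun t ht => LipschitzOnWith.of_dist_le_mul ?_⟩
  intro x hx y hy
  have h := dist_le_of_trajectories_ODE_of_mem (v := X) (s := fun _ => Metric.closedBall 0 R)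
    (a := 0) (b := T) (fun t ht => hC t (Ico_subset_Icc_self ht))
    (fun t _ => (hg.hasDerivAt x hx t).continuousAt.continuousWithinAt)
    (fun t _ => (hg.hasDerivAt x hx t).hasDerivWithinAt) (fun t _ => hR (hg.mem hX hx t))
    (fun t _ => (hg.hasDerivAt y hy t).continuousAt.continuousWithinAt)
    (fun t _ => (hg.hasDerivAt y hy t).hasDerivWithinAt) (fun t _ => hR (hg.mem hX hy t))
    le_rfl t ht
  rw [hg.map_zero x hx, hg.map_zero y hy, sub_zero, mul_comm] at h
  refine h.trans ?_
  change _ ≤ Real.exp (C * T) * _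
  gcongr
  exact ht.2

theorem continuousOn (hg : IsFlowOn D X g) (hX : IsC1Field X A) (hD : IsCompact D) (T : ℝ) :
    ContinuousOn (fun z : ℝ × E => g z.1 z.2) (Icc 0 T ×ˢ D) := by
  obtain ⟨C, hC⟩ := hg.exists_lipschitzOnWith hX hD T
  exact continuousOn_prod_of_continuousOn_lipschitzOnWith' _ C hC
    fun x hx t _ => (hg.hasDerivAt x hx t).continuousAt.continuousWithinAt

end

variable {D : Set (ℝ × ℝ)} {X : ℝ → ℝ × ℝ → ℝ × ℝ} {A : ℝ → ℝ × ℝ → ℝ × ℝ →L[ℝ] ℝ × ℝ}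
  {g : ℝ → ℝ × ℝ → ℝ × ℝ}

/-- Any solution of the variational equation is the derivative of the flow. -/
theorem hasFDerivWithinAt (hg : IsFlowOn D X g) (hX : IsC1Field X A) (hD : IsCompact D) {T : ℝ}
    {x : ℝ × ℝ} (hx : x ∈ D) {M : ℝ → ℝ × ℝ →L[ℝ] ℝ × ℝ}
    (hM0 : M 0 = ContinuousLinearMap.id ℝ _)
    (hM : ∀ v, ∀ t ∈ Icc 0 T, HasDerivWithinAt (fun t => M t v) (A t (g t x) (M t v)) (Icc 0 T) t)
    {t : ℝ} (ht : t ∈ Icc 0 T) : HasFDerivWithinAt (g t) (M t) D x := by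
  obtain ⟨R, hR⟩ := hD.isBounded.subset_closedBall 0
  obtain ⟨C, hC⟩ := hX.exists_bound 0 T R
  obtain ⟨L, hL⟩ := hg.exists_lipschitzOnWith hX hD T
  have hunif : UniformContinuousOn (fun z : ℝ × (ℝ × ℝ) => A z.1 z.2)
      (Icc 0 T ×ˢ Metric.closedBall (0 : ℝ × ℝ) R) :=
    (isCompact_Icc.prod (isCompact_closedBall _ _)).uniformContinuousOn_of_continuous
      hX.continuous_fderiv.continuousOn
  have hgb : gronwallBound 0 C L T ≥ 0 := by
    have := gronwallBound_mono le_rfl L.2 C.2 (ht.1.trans ht.2)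
    rwa [gronwallBound_x0] at this
  -- With zero initial value the Gronwall bound is linear in the forcing term, so a small enough `η`
  -- brings the final error below `c * ‖y - x‖`.
  have hlin : ∀ η : ℝ, gronwallBound 0 C (η * L) T = η * gronwallBound 0 C L T := by
    intro η
    unfold gronwallBound
    split_ifs <;> ring
  rw [hasFDerivWithinAt_iff_isLittleO, Asymptotics.isLittleO_iff]
  intro c hc
  obtain ⟨η, hη, hηc⟩ : ∃ η > 0, η * gronwallBound 0 C L T ≤ c := by
    refine ⟨c / (gronwallBound 0 C L T + 1), by positivity, ?_⟩
    rw [div_mul_eq_mul_div, div_le_iff₀ (by positivity)]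
    nlinarith
  obtain ⟨δ, hδ, hδA⟩ := Metric.uniformContinuousOn_iff.1 hunif η hη
  have hnear : ∀ᶠ y in nhdsWithin x D, y ∈ D ∧ dist y x < δ / (L + 1) :=
    (eventually_mem_nhdsWithin).and (eventually_nhdsWithin_of_eventually_nhds
      (Metric.ball_mem_nhds x (by positivity)))
  filter_upwards [hnear] with y hy
  obtain ⟨hyD, hyx⟩ := hy
  have hclose : ∀ s ∈ Icc 0 T, ‖g s y - g s x‖ ≤ L * ‖y - x‖ := fun s hs => by
    simpa [dist_eq_norm] using (hL s hs).dist_le_mul y hyD x hx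
  have hsmall : L * ‖y - x‖ < δ := by
    rw [dist_eq_norm, lt_div_iff₀ (by positivity)] at hyx
    nlinarith [norm_nonneg (y - x)]
  have hrem : ∀ s ∈ Icc 0 T, ‖X s (g s y) - X s (g s x) - A s (g s x) (g s y - g s x)‖
      ≤ η * L * ‖y - x‖ := by
    intro s hs
    -- The segment between the two trajectories may leave `D`, so the mean value inequality is used
    -- on a convex set: a large ball around `D` cut with the `δ`-ball on which `A s` varies by less
    -- than `η`.
    have h1 : ‖X s (g s y) - X s (g s x) - A s (g s x) (g s y - g s x)‖
        ≤ η * ‖g s y - g s x‖ := by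
      refine ((convex_closedBall (0 : ℝ × ℝ) R).inter
        (convex_ball (g s x) δ)).norm_image_sub_le_of_norm_hasFDerivWithin_le'
        (fun z _ => (hX.hasFDerivAt s z).hasFDerivWithinAt) (fun z hz => ?_)
        ⟨hR (hg.mem hX hx s), Metric.mem_ball_self hδ⟩
        ⟨hR (hg.mem hX hyD s), by
          rw [Metric.mem_ball, dist_eq_norm]; exact (hclose s hs).trans_lt hsmall⟩
      have := hδA (s, z) ⟨hs, hz.1⟩ (s, g s x) ⟨hs, hR (hg.mem hX hx s)⟩
        (by simpa [Prod.dist_eq, hδ] using hz.2)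
      rw [← dist_eq_norm]
      exact this.le
    calc _ ≤ _ := h1
      _ ≤ η * (L * ‖y - x‖) := by gcongr; exact hclose s hs
      _ = _ := by ring
  -- The error `e = g y - g x - M (y - x)` starts at `0` and satisfies `e' = A e + remainder`, with
  -- the remainder bounded by `hrem`.
  have hgron := norm_le_gronwallBound_of_norm_deriv_right_le (a := 0) (b := T) (δ := 0) (K := C)
    (ε := η * ‖y - x‖ * L)
    (f := fun s => g s y - g s x - M s (y - x))
    (f' := fun s => X s (g s y) - X s (g s x) - A s (g s x) (M s (y - x)))
    (fun s hs => (((hg.hasDerivAt y hyD s).sub (hg.hasDerivAt x hx s)).hasDerivWithinAt.sub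
      (hM (y - x) s hs)).continuousWithinAt)
    (fun s hs => ((((hg.hasDerivAt y hyD s).sub (hg.hasDerivAt x hx s)).hasDerivWithinAt.sub
      (hM (y - x) s (Ico_subset_Icc_self hs))).mono_of_mem_nhdsWithin
        (Icc_mem_nhdsGE_of_mem hs)))
    (by simp [hM0, hg.map_zero y hyD, hg.map_zero x hx])
    (fun s hs => by
      have hs' := Ico_subset_Icc_self hs
      have e : X s (g s y) - X s (g s x) - A s (g s x) (M s (y - x))
        = A s (g s x) (g s y - g s x - M s (y - x)) +
          (X s (g s y) - X s (g s x) - A s (g s x) (g s y - g s x)) := by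
        rw [map_sub (A s (g s x)) (g s y - g s x)]; abel
      rw [e]
      refine (norm_add_le _ _).trans (add_le_add
        ((A s (g s x)).le_of_opNorm_le (hC s hs' _ (hR (hg.mem hX hx s))) _) ?_)
      exact (hrem s hs').trans_eq (by ring)) t ht
  calc _ ≤ _ := hgron
    _ ≤ gronwallBound 0 C (η * ‖y - x‖ * L) T :=
      gronwallBound_mono le_rfl (by positivity) C.2 (by simpa using ht.2)
    _ = (η * gronwallBound 0 C L T) * ‖y - x‖ := by rw [hlin]; ring
    _ ≤ c * ‖y - x‖ := by gcongr

theorem det_eq_omegaForm (M : ℝ × ℝ →L[ℝ] ℝ × ℝ) :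
    M.det = omegaForm (M (1, 0)) (M (0, 1)) := by
  rw [ContinuousLinearMap.det, ← LinearMap.det_toMatrix (Module.Basis.finTwoProd ℝ),
    Matrix.det_fin_two]
  simp [LinearMap.toMatrix_apply, omegaForm]
  ring

/-- **Liouville's theorem**: the flow of an infinitesimally symplectic field preserves area. -/
theorem setIntegral_comp (hg : IsFlowOn D X g) (hX : IsC1Field X A) (hD : IsCompact D)
    (hA : ∀ t x u v, omegaForm (A t x u) v + omegaForm u (A t x v) = 0) {t : ℝ} (ht : 0 ≤ t)
    (f : ℝ × ℝ → ℝ) : ∫ x in D, f (g t x) = ∫ x in D, f x := by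
  have key : ∀ x, ∃ M : ℝ × ℝ →L[ℝ] ℝ × ℝ, x ∈ D → HasFDerivWithinAt (g t) M D x ∧ M.det = 1 := by
    intro x
    by_cases hx : x ∈ D
    swap
    · exact ⟨0, fun h => absurd h hx⟩
    have hB : ContinuousOn (fun s => A s (g s x)) (Icc 0 t) :=
      hX.continuous_fderiv.comp_continuousOn (continuousOn_id.prodMk
        fun s _ => (hg.hasDerivAt x hx s).continuousAt.continuousWithinAt)
    obtain ⟨u, hu0, hu⟩ := exists_solution_linear ht hB (1, 0)
    obtain ⟨v, hv0, hv⟩ := exists_solution_linear ht hB (0, 1)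
    -- The columns of `M` solve the variational equation from the standard basis. Its determinant is
    -- `omegaForm u v`, which is constant because `A` is infinitesimally symplectic.
    let M : ℝ → ℝ × ℝ →L[ℝ] ℝ × ℝ := fun s =>
      (ContinuousLinearMap.fst ℝ ℝ ℝ).smulRight (u s) +
        (ContinuousLinearMap.snd ℝ ℝ ℝ).smulRight (v s)
    refine ⟨M t, fun _ => ⟨hg.hasFDerivWithinAt hX hD hx ?_ ?_ (right_mem_Icc.2 ht), ?_⟩⟩
    · ext <;> simp [M, hu0, hv0]
    · intro w s hs
      have := ((hu s hs).const_smul w.1).add ((hv s hs).const_smul w.2)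
      simpa [M] using! this
    · have hder : ∀ s ∈ Icc 0 t, HasDerivWithinAt (fun s => omegaForm (u s) (v s)) 0 (Icc 0 t) s := by
        intro s hs
        have hu1 : HasDerivWithinAt (fun s => (u s).1) (A s (g s x) (u s)).1 (Icc 0 t) s :=
          (ContinuousLinearMap.fst ℝ ℝ ℝ).hasFDerivAt.comp_hasDerivWithinAt s (hu s hs)
        have hu2 : HasDerivWithinAt (fun s => (u s).2) (A s (g s x) (u s)).2 (Icc 0 t) s :=
          (ContinuousLinearMap.snd ℝ ℝ ℝ).hasFDerivAt.comp_hasDerivWithinAt s (hu s hs)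
        have hv1 : HasDerivWithinAt (fun s => (v s).1) (A s (g s x) (v s)).1 (Icc 0 t) s :=
          (ContinuousLinearMap.fst ℝ ℝ ℝ).hasFDerivAt.comp_hasDerivWithinAt s (hv s hs)
        have hv2 : HasDerivWithinAt (fun s => (v s).2) (A s (g s x) (v s)).2 (Icc 0 t) s :=
          (ContinuousLinearMap.snd ℝ ℝ ℝ).hasFDerivAt.comp_hasDerivWithinAt s (hv s hs)
        have := (hu1.mul hv2).sub (hu2.mul hv1)
        convert! this using 1
        have := hA s (g s x) (u s) (v s)
        simp only [omegaForm] at this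
        linarith
      have := constant_of_has_deriv_right_zero (fun s hs => (hder s hs).continuousWithinAt)
        (fun s hs => (hder s (Ico_subset_Icc_self hs)).mono_of_mem_nhdsWithin
          (Icc_mem_nhdsGE_of_mem hs)) t (right_mem_Icc.2 ht)
      rw [det_eq_omegaForm]
      simp only [hu0, hv0] at this
      simpa [M, omegaForm] using this
  choose M hM using key
  have h := integral_image_eq_integral_abs_det_fderiv_smul volume hD.measurableSet
    (fun x hx => (hM x hx).1) (hg.injOn hX t) f
  rw [hg.image_eq hX t] at h
  rw [h]
  refine setIntegral_congr_fun hD.measurableSet fun x hx => ?_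
  simp [(hM x hx).2]

end IsFlowOn

/-! ### Euclidean geometry of the plane; crossing a frontier -/

/-- The squared Euclidean length of a vector of the plane. -/
def normSqPlane (u : ℝ × ℝ) : ℝ := u.1 ^ 2 + u.2 ^ 2

/-- The unit vector of the plane with polar angle `θ`. -/
noncomputable def unitVec (θ : ℝ) : ℝ × ℝ := (Real.cos θ, Real.sin θ)

theorem polarCoord_symm_eq_smul (p : ℝ × ℝ) : polarCoord.symm p = p.1 • unitVec p.2 := by
  simp [unitVec, polarCoord]

theorem normSqPlane_smul_unitVec (r θ : ℝ) : normSqPlane (r • unitVec θ) = r ^ 2 := by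
  simp only [normSqPlane, unitVec, Prod.smul_mk, smul_eq_mul, mul_pow]
  rw [← mul_add, Real.cos_sq_add_sin_sq, mul_one]

theorem norm_unitVec_le (θ : ℝ) : ‖unitVec θ‖ ≤ 1 := by
  simp [unitVec, Prod.norm_def, Real.abs_cos_le_one, Real.abs_sin_le_one]

theorem normSqPlane_le (u : ℝ × ℝ) : normSqPlane u ≤ 2 * ‖u‖ ^ 2 := by
  have h1' : u.1 ^ 2 ≤ ‖u‖ ^ 2 := by
    rw [← sq_abs u.1]; exact pow_le_pow_left₀ (abs_nonneg _) (norm_fst_le u) 2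
  have h2' : u.2 ^ 2 ≤ ‖u‖ ^ 2 := by
    rw [← sq_abs u.2]; exact pow_le_pow_left₀ (abs_nonneg _) (norm_snd_le u) 2
  unfold normSqPlane
  linarith

theorem continuous_unitVec : Continuous unitVec := by
  unfold unitVec
  fun_prop

/-- Otherwise the open sets `interior D` and `Dᶜ` would separate `s`. -/
theorem IsPreconnected.inter_frontier_nonempty_of_isClosed {α : Type*} [TopologicalSpace α]
    {s D : Set α} (hs : IsPreconnected s) (hD : IsClosed D) (h₁ : (s ∩ D).Nonempty)
    (h₂ : (s ∩ Dᶜ).Nonempty) : (s ∩ frontier D).Nonempty := by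
  by_contra hne
  rw [not_nonempty_iff_eq_empty, hD.frontier_eq] at hne
  have hint : ∀ x ∈ s, x ∈ D → x ∈ interior D := fun x hx hxD => by
    by_contra h
    exact hne.subset ⟨hx, hxD, h⟩
  obtain ⟨x, hx, hxD⟩ := h₁
  obtain ⟨z, -, hz, hz'⟩ := hs (interior D) Dᶜ isOpen_interior hD.isOpen_compl
    (fun z hz => (em (z ∈ D)).imp (hint z hz) id) ⟨x, hx, hint x hx hxD⟩ h₂
  exact hz' (interior_subset hz)

/-! ### The Cauchy–Pompeiu formula -/

section IndicatorExtension

variable {D : Set (ℝ × ℝ)} {K : ℝ × ℝ → ℝ}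

/-- The extension by zero of a `C¹` function that vanishes on the frontier is Lipschitz. -/
theorem exists_lipschitzWith_indicator (hD : IsCompact D) (hK : ContDiff ℝ 1 K)
    (h0 : ∀ x ∈ frontier D, K x = 0) : ∃ C : NNReal, LipschitzWith C (D.indicator K) := by
  obtain ⟨R, hR⟩ := hD.isBounded.subset_closedBall 0
  obtain ⟨C, hC⟩ := (hK.locallyLipschitz.locallyLipschitzOn).exists_lipschitzOnWith_of_compact
    (isCompact_closedBall (0 : ℝ × ℝ) R)
  -- The segment from `x` to `z` meets the frontier at some `w`; there `K` vanishes, and `w` is no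
  -- farther from `x` than `z` is.
  have hout : ∀ x ∈ D, ∀ z ∉ D, dist (K x) 0 ≤ C * dist x z := by
    intro x hx z hz
    obtain ⟨w, hw, hwf⟩ := ((convex_segment (𝕜 := ℝ) x z).isPreconnected).inter_frontier_nonempty_of_isClosed
      hD.isClosed ⟨x, left_mem_segment ℝ x z, hx⟩ ⟨z, right_mem_segment ℝ x z, hz⟩
    have hwD : w ∈ D := hD.isClosed.frontier_subset hwf
    have hd := dist_add_dist_of_mem_segment hw
    rw [← h0 w hwf]
    refine (hC.dist_le_mul x (hR hx) w (hR hwD)).trans ?_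
    gcongr
    linarith [dist_nonneg (x := w) (y := z)]
  refine ⟨C, LipschitzWith.of_dist_le_mul fun x z => ?_⟩
  by_cases hx : x ∈ D <;> by_cases hz : z ∈ D
  · simpa [hx, hz] using hC.dist_le_mul x (hR hx) z (hR hz)
  · simpa only [indicator_of_mem hx, indicator_of_notMem hz] using hout x hx z hz
  · rw [dist_comm, dist_comm x]
    simpa only [indicator_of_mem hz, indicator_of_notMem hx] using hout z hz x hx
  · simp [hx, hz]
    positivity

theorem hasFDerivAt_indicator (hD : IsClosed D) (hK : Differentiable ℝ K) {x : ℝ × ℝ}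
    (hx : x ∉ frontier D) : HasFDerivAt (D.indicator K) (D.indicator (fderiv ℝ K) x) x := by
  by_cases hxD : x ∈ D
  · have hxi : x ∈ interior D := by
      by_contra h
      exact hx (hD.frontier_eq ▸ ⟨hxD, h⟩)
    rw [indicator_of_mem hxD]
    refine (hK x).hasFDerivAt.congr_of_eventuallyEq ?_
    filter_upwards [mem_interior_iff_mem_nhds.1 hxi] with z hz using indicator_of_mem hz K
  · rw [indicator_of_notMem hxD]
    refine (hasFDerivAt_const 0 x).congr_of_eventuallyEq ?_
    filter_upwards [hD.isOpen_compl.mem_nhds hxD] with z hz using indicator_of_notMem hz K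

/-- Change to polar coordinates in the integral of the indicator of a null set: the weight `r` is
positive, so the transformed indicator vanishes almost everywhere. -/
theorem ae_polar_of_ae {P : ℝ × ℝ → Prop} (hP : ∀ᵐ x, P x) :
    ∀ᵐ p ∂(volume.restrict polarCoord.target), P (polarCoord.symm p) := by
  obtain ⟨N, hN, hNm, hN0⟩ := exists_measurable_superset_of_null (ae_iff.1 hP)
  have h := lintegral_comp_polarCoord_symm (N.indicator 1)
  rw [lintegral_indicator_one hNm, hN0, lintegral_eq_zero_iff (by
    apply Measurable.mul
    · fun_prop
    · exact (measurable_one.indicator hNm).comp continuous_polarCoord_symm.measurable)] at h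
  filter_upwards [h, ae_restrict_mem polarCoord.open_target.measurableSet] with p hp hpt
  by_contra hn
  have hr : 0 < p.1 := hpt.1
  have : polarCoord.symm p ∈ N := hN hn
  rw [indicator_of_mem this] at hp
  simp [hr.not_ge] at hp

/-- **Cauchy–Pompeiu formula**, real form, for a function vanishing on the frontier. -/
theorem setIntegral_fderiv_div_normSqPlane (hD : IsCompact D) (hfr : volume (frontier D) = 0)
    (hK : ContDiff ℝ 1 K) (h0 : ∀ x ∈ frontier D, K x = 0) {y : ℝ × ℝ} (hy : y ∈ D) :
    ∫ x in D, fderiv ℝ K x (x - y) / normSqPlane (x - y) = -(2 * Real.pi) * K y := by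
  obtain ⟨R, hR⟩ := hD.isBounded.subset_closedBall 0
  obtain ⟨C, hC⟩ := exists_lipschitzWith_indicator hD hK h0
  obtain ⟨B, hB⟩ := hD.exists_bound_of_continuousOn (hK.continuous_fderiv one_ne_zero).continuousOn
  -- A radius beyond every point of `D` seen from `y`. `R` refers to the sup norm, while `r` is a
  -- Euclidean length: `r² ≤ 2 (2R)² = 8R² < (3R + 1)²`.
  set ρ : ℝ := 3 * R + 1 with hρ
  have hR0 : 0 ≤ R := by
    have := hR hy
    simp only [Metric.mem_closedBall, dist_zero_right] at this
    exact (norm_nonneg _).trans this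
  have hfar : ∀ r θ : ℝ, 0 ≤ r → y + r • unitVec θ ∈ D → r < ρ := by
    intro r θ hr h
    have h1 := hR h
    have h2 := hR hy
    simp only [Metric.mem_closedBall, dist_zero_right] at h1 h2
    have h3 : ‖r • unitVec θ‖ ≤ 2 * R := by
      have := norm_sub_le (y + r • unitVec θ) y
      rw [add_sub_cancel_left] at this
      linarith
    have h4 := normSqPlane_le (r • unitVec θ)
    rw [normSqPlane_smul_unitVec] at h4
    have h5 : ‖r • unitVec θ‖ ^ 2 ≤ (2 * R) ^ 2 := pow_le_pow_left₀ (norm_nonneg _) h3 2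
    nlinarith
  -- The radial derivative of the extension of `K` by zero. The polar weight `r` and the factor `r`
  -- of `x - y` cancel the denominator `r²`, leaving a bounded integrand.
  let ψ : ℝ × ℝ → ℝ := fun p =>
    D.indicator (fderiv ℝ K) (y + p.1 • unitVec p.2) (unitVec p.2)
  have hpt : Continuous fun p : ℝ × ℝ => y + p.1 • unitVec p.2 := by
    have := continuous_unitVec
    fun_prop
  have hψm : Measurable ψ := by
    have h1 : Measurable fun p : ℝ × ℝ => fderiv ℝ K (y + p.1 • unitVec p.2) (unitVec p.2) := by
      have := continuous_unitVec
      have := hK.continuous_fderiv one_ne_zero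
      exact ((this.comp hpt).clm_apply (by fun_prop)).measurable
    have h2 := h1.indicator (hpt.measurable hD.measurableSet)
    convert h2 using 1
    ext p
    by_cases hp : y + p.1 • unitVec p.2 ∈ D <;> simp [ψ, hp]
  have hψb : ∀ p, ‖ψ p‖ ≤ |B| := by
    intro p
    by_cases hp : y + p.1 • unitVec p.2 ∈ D
    · simp only [ψ, indicator_of_mem hp]
      refine ((fderiv ℝ K _).le_of_opNorm_le_of_le (hB _ hp) (norm_unitVec_le _)).trans ?_
      rw [mul_one]; exact le_abs_self B
    · simp [ψ, hp]
  have hψ0 : ∀ r θ : ℝ, ρ ≤ r → ψ (r, θ) = 0 := by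
    intro r θ hr
    have : y + r • unitVec θ ∉ D := fun h =>
      (hfar r θ (by linarith) h).not_ge hr
    simp [ψ, this]
  have hψi : IntegrableOn ψ polarCoord.target := by
    have h1 : IntegrableOn ψ (Ioc 0 ρ ×ˢ Ioo (-Real.pi) Real.pi) := by
      refine Measure.integrableOn_of_bounded (M := |B|) ?_ hψm.aestronglyMeasurable
        (ae_of_all _ hψb)
      refine ((Metric.isBounded_Ioc 0 ρ).prod (Metric.isBounded_Ioo _ _)).measure_lt_top.ne
    refine IntegrableOn.of_forall_sdiff_eq_zero h1
      polarCoord.open_target.measurableSet ?_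
    rintro ⟨r, θ⟩ ⟨⟨hr, hθ⟩, hn⟩
    refine hψ0 r θ ?_
    by_contra! h
    exact hn ⟨⟨hr, h.le⟩, hθ⟩
  -- By Fubini, almost every ray meets the null frontier in a null set of radii. On such a ray the
  -- extension by zero is Lipschitz, hence absolutely continuous, and falls from `K y` to `0`.
  have hinner : ∀ᵐ θ : ℝ, θ ∈ Ioo (-Real.pi) Real.pi → ∫ r in Ioi (0 : ℝ), ψ (r, θ) = -K y := by
    have hae : ∀ᵐ x : ℝ × ℝ, y + x ∉ frontier D := by
      have : ∀ᵐ x : ℝ × ℝ, x ∉ frontier D := by simpa [ae_iff] using hfr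
      exact (measurePreserving_add_left volume y).quasiMeasurePreserving.ae this
    have h1 := ae_polar_of_ae hae
    rw [polarCoord_target, Measure.volume_eq_prod, ← Measure.prod_restrict] at h1
    have h2 := Measure.ae_ae_of_ae_prod (Measure.measurePreserving_swap
      (μ := volume.restrict (Ioo (-Real.pi) Real.pi)) (ν := volume.restrict (Ioi (0 : ℝ)))
        |>.quasiMeasurePreserving.ae h1)
    rw [ae_restrict_iff' measurableSet_Ioo] at h2
    filter_upwards [h2] with θ hθ hθm
    have hθ := hθ hθm
    rw [ae_restrict_iff' measurableSet_Ioi] at hθ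
    let f : ℝ → ℝ := fun r => D.indicator K (y + r • unitVec θ)
    have hline : LipschitzWith 1 fun r : ℝ => y + r • unitVec θ := by
      refine LipschitzWith.of_dist_le_mul fun r s => ?_
      rw [dist_add_left, dist_eq_norm, ← sub_smul, norm_smul, NNReal.coe_one, one_mul,
        dist_eq_norm]
      exact mul_le_of_le_one_right (norm_nonneg _) (norm_unitVec_le θ)
    have hf : LipschitzWith (C * 1) f := hC.comp hline
    have hftc := (hf.lipschitzOnWith (s := uIcc 0 ρ)).absolutelyContinuousOnInterval.integral_deriv_eq_sub
    have hfρ : f ρ = 0 := by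
      have : y + ρ • unitVec θ ∉ D := fun h => (hfar ρ θ (by positivity) h).ne rfl
      simp [f, this]
    have hf0 : f 0 = K y := by simp [f, hy]
    rw [hfρ, hf0, zero_sub] at hftc
    rw [← hftc, intervalIntegral.integral_of_le (by positivity)]
    rw [setIntegral_eq_of_subset_of_forall_sdiff_eq_zero measurableSet_Ioi
      (Ioc_subset_Ioi_self : Ioc 0 ρ ⊆ Ioi 0)]
    · refine setIntegral_congr_ae measurableSet_Ioc ?_
      filter_upwards [hθ] with r hr hrm
      have hr := hr hrm.1
      simp only [Prod.swap_prod_mk, polarCoord_symm_eq_smul] at hr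
      have hd := hasFDerivAt_indicator hD.isClosed (hK.differentiable one_ne_zero) hr
      have hl : HasDerivAt (fun r : ℝ => y + r • unitVec θ) (unitVec θ) r := by
        simpa using ((hasDerivAt_id r).smul_const (unitVec θ)).const_add y
      exact (hd.comp_hasDerivAt r hl).deriv.symm
    · intro r hr
      refine hψ0 r θ ?_
      by_contra! h
      exact hr.2 ⟨hr.1, h.le⟩
  calc ∫ x in D, fderiv ℝ K x (x - y) / normSqPlane (x - y)
      = ∫ x, D.indicator (fun x => fderiv ℝ K x (x - y) / normSqPlane (x - y)) x :=
        (integral_indicator hD.measurableSet).symm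
    _ = ∫ x, D.indicator (fun x => fderiv ℝ K x (x - y) / normSqPlane (x - y)) (y + x) :=
        (integral_add_left_eq_self _ y).symm
    _ = ∫ p in polarCoord.target, ψ p := by
        rw [← integral_comp_polarCoord_symm]
        refine setIntegral_congr_fun polarCoord.open_target.measurableSet fun p hp => ?_
        have hr : 0 < p.1 := hp.1
        simp only [polarCoord_symm_eq_smul, ψ]
        by_cases h : y + p.1 • unitVec p.2 ∈ D
        · simp only [indicator_of_mem h, add_sub_cancel_left, normSqPlane_smul_unitVec, map_smul,
            smul_eq_mul]
          field_simp
        · simp [h]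
    _ = ∫ θ in Ioo (-Real.pi) Real.pi, ∫ r in Ioi (0 : ℝ), ψ (r, θ) := by
        rw [IntegrableOn, polarCoord_target, Measure.volume_eq_prod, ← Measure.prod_restrict] at hψi
        rw [polarCoord_target, Measure.volume_eq_prod, ← Measure.prod_restrict]
        exact integral_prod_symm ψ hψi
    _ = ∫ θ in Ioo (-Real.pi) Real.pi, -K y := setIntegral_congr_ae measurableSet_Ioo hinner
    _ = _ := by
        rw [setIntegral_const, Measure.real, Real.volume_Ioo, ENNReal.toReal_ofReal (by
          linarith [Real.pi_pos])]
        simp only [smul_eq_mul]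
        ring

end IndicatorExtension

/-! ### The angular velocity kernel and its mean over pairs -/

theorem norm_sq_le_normSqPlane (u : ℝ × ℝ) : ‖u‖ ^ 2 ≤ normSqPlane u := by
  rw [Prod.norm_def, normSqPlane]
  rcases max_choice ‖u.1‖ ‖u.2‖ with h | h <;> rw [h] <;>
    simp only [Real.norm_eq_abs, sq_abs] <;> nlinarith [sq_nonneg u.1, sq_nonneg u.2]

/-- In dimension two the radial density is proportional to `r`, which cancels `r⁻¹`. -/
theorem integrable_indicator_inv_norm (R : ℝ) :
    Integrable fun u : ℝ × ℝ => (Iio R).indicator (fun r : ℝ => r⁻¹) ‖u‖ := by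
  rw [integrable_fun_norm_addHaar (volume : Measure (ℝ × ℝ))
    (f := (Iio R).indicator (fun r : ℝ => r⁻¹))]
  have h : IntegrableOn (fun _ : ℝ => (1 : ℝ)) (Ioo 0 R) := by
    rw [integrableOn_const_iff]; simp
  refine IntegrableOn.of_forall_sdiff_eq_zero
    (h.congr_fun (fun r hr => ?_) measurableSet_Ioo) measurableSet_Ioi fun r hr => ?_
  · have : r ≠ 0 := hr.1.ne'
    simp [indicator_of_mem (show r ∈ Iio R from hr.2), this]
  · have : r ∉ Iio R := fun h => hr.2 ⟨hr.1, h⟩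
    simp [this]

/-- The angular velocity of the difference `x - y` when `x` and `y` move along the field `X`. -/
noncomputable def pairKernel (X : ℝ × ℝ → ℝ × ℝ) (x y : ℝ × ℝ) : ℝ :=
  omegaForm (x - y) (X x - X y) / normSqPlane (x - y)

/-- The symplectic duality between covectors and vectors of the plane. -/
noncomputable def symplDual : (ℝ × ℝ →L[ℝ] ℝ) →L[ℝ] ℝ × ℝ :=
  (-(ContinuousLinearMap.apply ℝ ℝ ((0, 1) : ℝ × ℝ))).prod
    (ContinuousLinearMap.apply ℝ ℝ ((1, 0) : ℝ × ℝ))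

theorem omegaForm_symplDual (φ : ℝ × ℝ →L[ℝ] ℝ) (d : ℝ × ℝ) : omegaForm d (symplDual φ) = φ d := by
  have : d = d.1 • ((1, 0) : ℝ × ℝ) + d.2 • ((0, 1) : ℝ × ℝ) := by ext <;> simp
  conv_rhs => rw [this, map_add, map_smul, map_smul]
  simp [omegaForm, symplDual]

/-- The Hamiltonian vector field of a function. -/
noncomputable def symplGradient (K : ℝ × ℝ → ℝ) (x : ℝ × ℝ) : ℝ × ℝ := symplDual (fderiv ℝ K x)

theorem omegaForm_symplGradient (K : ℝ × ℝ → ℝ) (x d : ℝ × ℝ) :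
    omegaForm d (symplGradient K x) = fderiv ℝ K x d :=
  omegaForm_symplDual _ _

theorem abs_omegaForm_le (u v : ℝ × ℝ) : |omegaForm u v| ≤ 2 * ‖u‖ * ‖v‖ := by
  have h1 := mul_le_mul (norm_fst_le u) (norm_snd_le v) (norm_nonneg _) (norm_nonneg _)
  have h2 := mul_le_mul (norm_snd_le u) (norm_fst_le v) (norm_nonneg _) (norm_nonneg _)
  simp only [Real.norm_eq_abs, ← abs_mul] at h1 h2
  unfold omegaForm
  linarith [abs_sub (u.1 * v.2) (u.2 * v.1)]

theorem abs_pairKernel_le {X : ℝ × ℝ → ℝ × ℝ} {C : NNReal} {x y : ℝ × ℝ}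
    (h : ‖X x - X y‖ ≤ C * ‖x - y‖) : |pairKernel X x y| ≤ 2 * C := by
  have hC : (0 : ℝ) ≤ C := C.2
  rcases eq_or_ne x y with rfl | hxy
  -- On the diagonal the kernel is `0 / 0 = 0`.
  · simp [pairKernel, omegaForm, hC]
  have hpos : 0 < ‖x - y‖ := norm_pos_iff.2 (sub_ne_zero.2 hxy)
  have hn := norm_sq_le_normSqPlane (x - y)
  have hn0 : 0 < normSqPlane (x - y) := lt_of_lt_of_le (by positivity) hn
  rw [pairKernel, abs_div, abs_of_pos hn0, div_le_iff₀ hn0]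
  calc _ ≤ 2 * ‖x - y‖ * ‖X x - X y‖ := abs_omegaForm_le _ _
    _ ≤ 2 * ‖x - y‖ * (C * ‖x - y‖) := by gcongr
    _ = 2 * C * ‖x - y‖ ^ 2 := by ring
    _ ≤ _ := by gcongr

section

variable {D : Set (ℝ × ℝ)} {K : ℝ × ℝ → ℝ}

theorem integrable_fderiv_div_normSqPlane (hD : IsCompact D) (hK : ContDiff ℝ 1 K) :
    Integrable (fun z : (ℝ × ℝ) × (ℝ × ℝ) =>
      fderiv ℝ K z.2 (z.2 - z.1) / normSqPlane (z.2 - z.1))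
      ((volume.restrict D).prod (volume.restrict D)) := by
  obtain ⟨R, hR⟩ := hD.isBounded.subset_closedBall 0
  obtain ⟨B, hB⟩ := hD.exists_bound_of_continuousOn (hK.continuous_fderiv one_ne_zero).continuousOn
  have hg := (integrable_indicator_inv_norm (2 * R + 1)).const_mul |B|
  have hf : Integrable (D.indicator (fun _ => (1 : ℝ))) := by
    rw [integrable_indicator_iff hD.measurableSet, integrableOn_const_iff]
    exact Or.inr hD.measure_lt_top
  -- The kernel is dominated by `|B| / ‖x - y‖`, truncated beyond the diameter of `D`; the
  -- dominating function is the integrand of a convolution of two integrable functions.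
  have hc := (hf.convolution_integrand (ContinuousLinearMap.mul ℝ ℝ) hg).mono_measure
    (Measure.prod_mono (Measure.restrict_le_self (s := D)) (Measure.restrict_le_self (s := D)))
  refine hc.mono ?_ ?_
  · have h1 : Continuous fun z : (ℝ × ℝ) × (ℝ × ℝ) => fderiv ℝ K z.2 (z.2 - z.1) :=
      ((hK.continuous_fderiv one_ne_zero).comp continuous_snd).clm_apply (by fun_prop)
    have h2 : Continuous fun z : (ℝ × ℝ) × (ℝ × ℝ) => normSqPlane (z.2 - z.1) := by
      unfold normSqPlane; fun_prop
    exact (h1.measurable.div h2.measurable).aestronglyMeasurable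
  · rw [Measure.prod_restrict]
    filter_upwards [ae_restrict_mem (hD.measurableSet.prod hD.measurableSet)] with z hz
    have hx := hR hz.2
    have hy := hR hz.1
    simp only [Metric.mem_closedBall, dist_zero_right] at hx hy
    have hlt : ‖z.1 - z.2‖ < 2 * R + 1 := by linarith [norm_sub_le z.1 z.2]
    simp only [indicator_of_mem hz.2, indicator_of_mem (show ‖z.1 - z.2‖ ∈ Iio _ from hlt),
      ContinuousLinearMap.mul_apply', one_mul]
    rw [norm_sub_rev z.1]
    set u := z.2 - z.1
    rcases eq_or_ne u 0 with hu | hu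
    · simp [hu]
    have hpos : 0 < ‖u‖ := norm_pos_iff.2 hu
    have hn := norm_sq_le_normSqPlane u
    have hn0 : 0 < normSqPlane u := lt_of_lt_of_le (by positivity) hn
    rw [norm_div, norm_mul, Real.norm_of_nonneg hn0.le, norm_inv, norm_norm, Real.norm_eq_abs |B|,
      abs_abs, ← div_eq_mul_inv, div_le_div_iff₀ hn0 hpos]
    calc _ ≤ (|B| * ‖u‖) * ‖u‖ := by
          gcongr
          exact (fderiv ℝ K z.2).le_of_opNorm_le ((hB _ hz.2).trans (le_abs_self B)) u
      _ = |B| * ‖u‖ ^ 2 := by ring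
      _ ≤ _ := by gcongr

/-- The mean angular velocity over all pairs of points of `D` is `-4π ∫ K`. -/
theorem integral_pairKernel (hD : IsCompact D) (hfr : volume (frontier D) = 0)
    (hK : ContDiff ℝ 1 K) (h0 : ∀ x ∈ frontier D, K x = 0) :
    ∫ z, pairKernel (symplGradient K) z.1 z.2 ∂((volume.restrict D).prod (volume.restrict D))
      = -(4 * Real.pi) * ∫ x in D, K x := by
  have hi := integrable_fderiv_div_normSqPlane hD hK
  have hval : ∫ z : (ℝ × ℝ) × (ℝ × ℝ), fderiv ℝ K z.2 (z.2 - z.1) / normSqPlane (z.2 - z.1)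
      ∂((volume.restrict D).prod (volume.restrict D)) = -(2 * Real.pi) * ∫ x in D, K x := by
    rw [integral_prod _ hi, ← integral_const_mul]
    exact setIntegral_congr_fun hD.measurableSet fun y hy =>
      setIntegral_fderiv_div_normSqPlane hD hfr hK h0 hy
  -- The bounded kernel splits into a singular but integrable term and its reflection in the
  -- diagonal; each contributes `-2π ∫ K`.
  have hsplit : (fun z : (ℝ × ℝ) × (ℝ × ℝ) => pairKernel (symplGradient K) z.1 z.2) = fun z =>
      fderiv ℝ K z.2 (z.2 - z.1) / normSqPlane (z.2 - z.1) +
      fderiv ℝ K z.swap.2 (z.swap.2 - z.swap.1) / normSqPlane (z.swap.2 - z.swap.1) := by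
    ext ⟨x, y⟩
    have h1 : omegaForm (x - y) (symplGradient K x - symplGradient K y) =
        fderiv ℝ K x (x - y) + fderiv ℝ K y (y - x) := by
      rw [← omegaForm_symplGradient, ← omegaForm_symplGradient]
      simp only [omegaForm, Prod.fst_sub, Prod.snd_sub]
      ring
    have h2 : normSqPlane (y - x) = normSqPlane (x - y) := by
      simp only [normSqPlane, Prod.fst_sub, Prod.snd_sub]
      ring
    simp only [pairKernel, h1, Prod.swap_prod_mk, h2]
    ring
  rw [hsplit]
  refine (integral_add hi hi.swap).trans ?_
  have hswap := integral_prod_swap (μ := volume.restrict D) (ν := volume.restrict D)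
    (fun z : (ℝ × ℝ) × (ℝ × ℝ) => fderiv ℝ K z.2 (z.2 - z.1) / normSqPlane (z.2 - z.1))
  simp only [Function.comp_apply]
  rw [hswap, hval]
  ring

end

/-! ### Topology of the disk and its boundary -/

/-- The open unit disk of the plane. -/
def openUnitDisk : Set (ℝ × ℝ) := {x | normSqPlane x < 1}

theorem continuous_normSqPlane : Continuous normSqPlane := by
  unfold normSqPlane; fun_prop

theorem isCompact_closedUnitDisk : IsCompact closedUnitDisk := by
  refine Metric.isCompact_of_isClosed_isBounded
    (isClosed_le continuous_normSqPlane continuous_const) ?_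
  refine (Metric.isBounded_closedBall (x := (0 : ℝ × ℝ)) (r := 1)).subset fun x hx => ?_
  rw [Metric.mem_closedBall, dist_zero_right]
  have h : ‖x‖ ^ 2 ≤ 1 := (norm_sq_le_normSqPlane x).trans hx
  exact (sq_le_one_iff₀ (norm_nonneg _)).1 h

theorem isOpen_openUnitDisk : IsOpen openUnitDisk :=
  isOpen_lt continuous_normSqPlane continuous_const

theorem openUnitDisk_subset : openUnitDisk ⊆ closedUnitDisk := fun _ hx => le_of_lt (α := ℝ) hx

/-- The norm of `ℝ × ℝ` is the sup norm, so the Euclidean circle is recognised as a sphere in `ℂ`,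
which is null. -/
theorem volume_unitCircle : volume {x : ℝ × ℝ | normSqPlane x = 1} = 0 := by
  have h := Complex.volume_preserving_equiv_real_prod.symm.measure_preimage_equiv
    (Metric.sphere (0 : ℂ) 1)
  rw [Measure.addHaar_sphere] at h
  convert h using 2
  ext x
  simp only [mem_ofPred_eq, mem_preimage, mem_sphere_iff_norm, sub_zero, normSqPlane]
  rw [Complex.norm_def, Real.sqrt_eq_one, Complex.normSq_apply]
  simp [Complex.measurableEquivRealProd, pow_two]

theorem exists_eq_unitVec {u : ℝ × ℝ} (hu : normSqPlane u = 1) : ∃ θ, u = unitVec θ := by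
  let z : ℂ := ⟨u.1, u.2⟩
  have hz : ‖z‖ = 1 := by
    rw [Complex.norm_def, Real.sqrt_eq_one, Complex.normSq_apply]
    simpa [normSqPlane, z, pow_two] using hu
  have hz0 : z ≠ 0 := by
    intro h; simp [h] at hz
  refine ⟨z.arg, Prod.ext ?_ ?_⟩
  · simp [unitVec, Complex.cos_arg hz0, hz, z]
  · simp [unitVec, Complex.sin_arg, hz, z]

theorem hasDerivAt_unitVec (θ : ℝ) :
    HasDerivAt unitVec (-(unitVec θ).2, (unitVec θ).1) θ :=
  (Real.hasDerivAt_cos θ).prodMk (Real.hasDerivAt_sin θ)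

/-- The shear `(a, b) ↦ (a, a + b)` carries `ℂ × (ℂ ∖ {0})` onto this set, and a punctured real
plane is connected. -/
theorem isPreconnected_setOf_fst_ne_snd :
    IsPreconnected {p : ℂ × ℂ | p.1 ≠ p.2} := by
  have h1 : IsPreconnected (univ ×ˢ ({0}ᶜ : Set ℂ) : Set (ℂ × ℂ)) :=
    isPreconnected_univ.prod
      (isConnected_compl_singleton_of_one_lt_rank (by simp) 0).isPreconnected
  have h2 := h1.image (fun p : ℂ × ℂ => (p.1, p.1 + p.2)) (by fun_prop)
  convert h2 using 1
  ext ⟨a, b⟩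
  simp only [mem_ofPred_eq, mem_image, mem_prod, mem_univ, true_and, mem_compl_iff,
    mem_singleton_iff, Prod.mk.injEq, Prod.exists]
  constructor
  · intro h
    exact ⟨a, b - a, sub_ne_zero.2 (Ne.symm h), rfl, by ring⟩
  · rintro ⟨c, d, hd, rfl, rfl⟩ h
    exact hd (by simpa using h)

/-- The open unit disk is an injective continuous image of the complex plane. -/
theorem exists_continuous_injective_onto_openUnitDisk : ∃ j : ℂ → ℝ × ℝ, Continuous j ∧
    Function.Injective j ∧ range j = openUnitDisk := by
  let b := OpenPartialHomeomorph.univUnitBall (E := ℂ)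
  have hb : Continuous b := by
    rw [← continuousOn_univ]; exact b.continuousOn_toFun
  refine ⟨fun z => Complex.equivRealProdCLM (b z), by fun_prop, ?_, ?_⟩
  · intro z w h
    exact b.injOn (mem_univ z) (mem_univ w) (Complex.equivRealProdCLM.injective h)
  · have himg : range b = Metric.ball 0 1 := by
      rw [← image_univ]; exact b.image_source_eq_target
    have hn : ∀ z : ℂ, normSqPlane (Complex.equivRealProdCLM z) = ‖z‖ ^ 2 := fun z => by
      rw [← Complex.normSq_eq_norm_sq, Complex.normSq_apply]
      simp [normSqPlane, pow_two]
    ext x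
    constructor
    · rintro ⟨z, rfl⟩
      have : b z ∈ Metric.ball (0 : ℂ) 1 := himg ▸ mem_range_self z
      rw [mem_ball_zero_iff] at this
      change normSqPlane _ < 1
      rw [hn]
      exact (sq_lt_one_iff₀ (norm_nonneg _)).2 this
    · intro hx
      obtain ⟨w, rfl⟩ := Complex.equivRealProdCLM.surjective x
      have : ‖w‖ ^ 2 < 1 := hn w ▸ hx
      have : w ∈ range b := by
        rw [himg, mem_ball_zero_iff]; exact (sq_lt_one_iff₀ (norm_nonneg _)).1 this
      obtain ⟨z, rfl⟩ := this
      exact ⟨z, rfl⟩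

section Disk

variable {Φ : OpenPartialHomeomorph (ℝ × ℝ) (ℝ × ℝ)}

theorem isCompact_image_closedUnitDisk (hs : closedUnitDisk ⊆ Φ.source) :
    IsCompact (Φ '' closedUnitDisk) :=
  isCompact_closedUnitDisk.image_of_continuousOn (Φ.continuousOn.mono hs)

/-- The image of the open disk is open, hence interior to the image of the closed disk. -/
theorem frontier_image_closedUnitDisk_subset (hs : closedUnitDisk ⊆ Φ.source) :
    frontier (Φ '' closedUnitDisk) ⊆ Φ '' {x | normSqPlane x = 1} := by
  rw [(isCompact_image_closedUnitDisk hs).isClosed.frontier_eq]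
  rintro _ ⟨⟨u, hu, rfl⟩, hn⟩
  refine ⟨u, ?_, rfl⟩
  by_contra h
  refine hn ?_
  have hlt : u ∈ openUnitDisk := lt_of_le_of_ne hu h
  have hopen := Φ.isOpen_image_of_subset_source isOpen_openUnitDisk (openUnitDisk_subset.trans hs)
  exact interior_maximal (image_mono openUnitDisk_subset) hopen (mem_image_of_mem Φ hlt)

theorem volume_image_unitCircle (hs : closedUnitDisk ⊆ Φ.source)
    (hΦ : ContDiffOn ℝ 2 Φ Φ.source) : volume (Φ '' {x | normSqPlane x = 1}) = 0 :=
  addHaar_image_eq_zero_of_differentiableOn_of_addHaar_eq_zero volume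
    ((hΦ.differentiableOn two_ne_zero).mono fun _ hx => hs (le_of_eq hx)) volume_unitCircle

theorem frontier_image_closedUnitDisk_nonempty (hs : closedUnitDisk ⊆ Φ.source) :
    (frontier (Φ '' closedUnitDisk)).Nonempty := by
  rw [nonempty_frontier_iff]
  refine ⟨⟨Φ 0, 0, by simp [closedUnitDisk], rfl⟩, ?_⟩
  exact (isCompact_image_closedUnitDisk hs).ne_univ

/-- Integer-valued continuous functions of pairs of distinct points of a disk are constant on
pairs of points of the image of the open disk. -/
theorem exists_int_eq_of_continuousOn (hs : closedUnitDisk ⊆ Φ.source)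
    {f : (ℝ × ℝ) × (ℝ × ℝ) → ℝ}
    (hf : ContinuousOn f {z | z.1 ∈ Φ '' closedUnitDisk ∧ z.2 ∈ Φ '' closedUnitDisk ∧ z.1 ≠ z.2})
    (hint : ∀ x ∈ Φ '' closedUnitDisk, ∀ y ∈ Φ '' closedUnitDisk, x ≠ y →
      ∃ n : ℤ, f (x, y) = n) :
    ∃ n : ℤ, ∀ x ∈ Φ '' openUnitDisk, ∀ y ∈ Φ '' openUnitDisk, x ≠ y → f (x, y) = n := by
  obtain ⟨j, hj, hinj, hrange⟩ := exists_continuous_injective_onto_openUnitDisk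
  have hmem : ∀ z, j z ∈ closedUnitDisk := fun z =>
    openUnitDisk_subset (hrange ▸ mem_range_self z)
  let ι : ℂ → ℝ × ℝ := fun z => Φ (j z)
  have hι : Continuous ι := by
    rw [← continuousOn_univ]
    exact Φ.continuousOn.comp hj.continuousOn fun z _ => hs (hmem z)
  have hιinj : Function.Injective ι := fun z w h =>
    hinj (Φ.injOn (hs (hmem z)) (hs (hmem w)) h)
  have hιD : ∀ z, ι z ∈ Φ '' closedUnitDisk := fun z => mem_image_of_mem Φ (hmem z)
  have hF : ContinuousOn (fun p : ℂ × ℂ => f (ι p.1, ι p.2)) {p | p.1 ≠ p.2} :=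
    hf.comp (by fun_prop) fun p hp => ⟨hιD _, hιD _, hιinj.ne hp⟩
  have hmaps : MapsTo (fun p : ℂ × ℂ => f (ι p.1, ι p.2)) {p | p.1 ≠ p.2}
      (range ((↑) : ℤ → ℝ)) := fun p hp => by
    obtain ⟨n, hn⟩ := hint _ (hιD p.1) _ (hιD p.2) (hιinj.ne hp)
    exact ⟨n, hn.symm⟩
  have : DiscreteTopology (range ((↑) : ℤ → ℝ)) :=
    Int.isClosedEmbedding_coe_real.isEmbedding.toHomeomorph.symm.isEmbedding.discreteTopology
  have hconst := fun p hp q hq =>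
    isPreconnected_setOf_fst_ne_snd.constant_of_mapsTo ⟨this⟩ hF hmaps (x := p) (y := q) hp hq
  obtain ⟨n, hn⟩ := hint _ (hιD 0) _ (hιD 1) (hιinj.ne zero_ne_one)
  refine ⟨n, ?_⟩
  rintro _ ⟨u, hu, rfl⟩ _ ⟨v, hv, rfl⟩ huv
  rw [← hrange] at hu hv
  obtain ⟨z, rfl⟩ := hu
  obtain ⟨w, rfl⟩ := hv
  rw [← hn]
  exact hconst (z, w) (fun h => huv (by simp only at h; rw [h])) (0, 1) zero_ne_one

/-- A Hamiltonian whose trajectories through the boundary stay in the disk is constant along the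
boundary. -/
theorem eq_on_image_unitCircle (hs : closedUnitDisk ⊆ Φ.source)
    (hΦ : ContDiffOn ℝ 2 Φ Φ.source) (hΦs : ContDiffOn ℝ 2 Φ.symm Φ.target)
    {K : ℝ × ℝ → ℝ} (hK : Differentiable ℝ K) {t : ℝ}
    (hinv : ∀ x ∈ Φ '' closedUnitDisk, ∃ γ : ℝ → ℝ × ℝ, HasDerivAt γ (symplGradient K x) t ∧
      γ t = x ∧ ∀ s, γ s ∈ Φ '' closedUnitDisk)
    {x y : ℝ × ℝ} (hx : x ∈ Φ '' {x | normSqPlane x = 1})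
    (hy : y ∈ Φ '' {x | normSqPlane x = 1}) : K x = K y := by
  have hdiff : ∀ u ∈ Φ.source, DifferentiableAt ℝ Φ u := fun u hu =>
    (hΦ.differentiableOn two_ne_zero).differentiableAt (Φ.open_source.mem_nhds hu)
  have hdiffs : ∀ u ∈ Φ.target, DifferentiableAt ℝ Φ.symm u := fun u hu =>
    (hΦs.differentiableOn two_ne_zero).differentiableAt (Φ.open_target.mem_nhds hu)
  -- The derivative of `K` along the tangent of the boundary vanishes, because the Hamiltonian field
  -- is parallel to that tangent and `dK` is the pairing of `omegaForm` with the field.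
  have key : ∀ u, normSqPlane u = 1 → fderiv ℝ K (Φ u) (fderiv ℝ Φ u (-u.2, u.1)) = 0 := by
    intro u hu
    have hucl : u ∈ closedUnitDisk := le_of_eq hu
    have hus := hs hucl
    obtain ⟨γ, hγ, hγt, hγD⟩ := hinv (Φ u) (mem_image_of_mem Φ hucl)
    set X := symplGradient K (Φ u) with hX
    have hsymm := (hdiffs (Φ u) (Φ.map_source hus)).hasFDerivAt
    set S := fderiv ℝ Φ.symm (Φ u) with hS
    have hback : fderiv ℝ Φ u (S X) = X := by
      have h1 : HasFDerivAt Φ (fderiv ℝ Φ u) (Φ.symm (Φ u)) := by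
        rw [Φ.left_inv hus]; exact (hdiff u hus).hasFDerivAt
      have h2 := h1.comp (Φ u) hsymm
      have h3 : HasFDerivAt (Φ ∘ Φ.symm) (ContinuousLinearMap.id ℝ (ℝ × ℝ)) (Φ u) :=
        (hasFDerivAt_id _).congr_of_eventuallyEq (by
          filter_upwards [Φ.open_target.mem_nhds (Φ.map_source hus)] with z hz
          exact Φ.right_inv hz)
      exact congrArg (fun L => L X) (h2.unique h3)
    have hcurve : HasDerivAt (fun s => Φ.symm (γ s)) (S X) t :=
      HasFDerivAt.comp_hasDerivAt (l := Φ.symm) t (by rw [hγt]; exact hsymm) hγ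
    have hc1 : HasDerivAt (fun s => (Φ.symm (γ s)).1) (S X).1 t :=
      (ContinuousLinearMap.fst ℝ ℝ ℝ).hasFDerivAt.comp_hasDerivAt t hcurve
    have hc2 : HasDerivAt (fun s => (Φ.symm (γ s)).2) (S X).2 t :=
      (ContinuousLinearMap.snd ℝ ℝ ℝ).hasFDerivAt.comp_hasDerivAt t hcurve
    have hρ := (hc1.pow 2).add (hc2.pow 2)
    -- The curve stays in the disk before and after time `t`, so its squared radius in the chart is
    -- maximal at `t`, where it equals `1`. Hence the velocity in the chart is orthogonal to `u`.
    have hmax : IsLocalMax (fun s => (Φ.symm (γ s)).1 ^ 2 + (Φ.symm (γ s)).2 ^ 2) t := by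
      refine Filter.Eventually.of_forall fun s => ?_
      simp only [hγt, Φ.left_inv hus]
      obtain ⟨v, hv, hvs⟩ := hγD s
      rw [← hvs, Φ.left_inv (hs hv)]
      exact le_of_le_of_eq hv hu.symm
    have hzero := hmax.hasDerivAt_eq_zero hρ
    rw [hγt, Φ.left_inv hus] at hzero
    have horth : u.1 * (S X).1 + u.2 * (S X).2 = 0 := by
      norm_num at hzero
      linarith
    set c := -u.2 * (S X).1 + u.1 * (S X).2
    have hu' : u.1 ^ 2 + u.2 ^ 2 = 1 := hu
    have hpar : S X = c • ((-u.2, u.1) : ℝ × ℝ) := by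
      ext
      · simp only [Prod.smul_mk, smul_eq_mul, c]
        linear_combination u.1 * horth - (S X).1 * hu'
      · simp only [Prod.smul_mk, smul_eq_mul, c]
        linear_combination u.2 * horth - (S X).2 * hu'
    rw [← omegaForm_symplGradient, ← hX, ← hback, hpar, map_smul]
    simp [omegaForm]
    ring
  have hconst : ∀ θ φ : ℝ, K (Φ (unitVec θ)) = K (Φ (unitVec φ)) := by
    have hn : ∀ θ, normSqPlane (unitVec θ) = 1 := fun θ => by
      simpa using normSqPlane_smul_unitVec 1 θ
    have hd : ∀ θ, HasDerivAt (fun θ => K (Φ (unitVec θ))) 0 θ := fun θ => by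
      have h1 := (hdiff _ (hs (le_of_eq (hn θ)))).hasFDerivAt.comp_hasDerivAt θ
        (hasDerivAt_unitVec θ)
      have h2 := (hK (Φ (unitVec θ))).hasFDerivAt.comp_hasDerivAt θ h1
      rwa [key _ (hn θ)] at h2
    exact fun θ φ => is_const_of_deriv_eq_zero (fun θ => (hd θ).differentiableAt)
      (fun θ => (hd θ).deriv) θ φ
  obtain ⟨u, hu, rfl⟩ := hx
  obtain ⟨v, hv, rfl⟩ := hy
  obtain ⟨θ, rfl⟩ := exists_eq_unitVec hu
  obtain ⟨φ, rfl⟩ := exists_eq_unitVec hv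
  exact hconst θ φ

end Disk

/-! ### Total rotation of a pair of points -/

/-- A nonvanishing curve is the exponential of the integral of its logarithmic derivative. -/
theorem eq_mul_exp_integral {z z' : ℝ → ℂ} (hz : ∀ t, HasDerivAt z (z' t) t)
    (hz' : Continuous z') (h0 : ∀ t, z t ≠ 0) (T : ℝ) :
    z T = z 0 * Complex.exp (∫ t in (0 : ℝ)..T, z' t / z t) := by
  have hzc : Continuous z := continuous_iff_continuousAt.2 fun t => (hz t).continuousAt
  have hq : Continuous fun t => z' t / z t := hz'.div hzc h0
  have hd : ∀ t, HasDerivAt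
      (fun s => z s * Complex.exp (-∫ t in (0 : ℝ)..s, z' t / z t)) 0 t := fun t => by
    have h1 := hq.integral_hasStrictDerivAt 0 t |>.hasDerivAt
    convert! (hz t).mul h1.fun_neg.cexp using 1
    field_simp [h0 t]
    ring
  have h := is_const_of_deriv_eq_zero (fun t => (hd t).differentiableAt) (fun t => (hd t).deriv) T 0
  simp only [intervalIntegral.integral_same, neg_zero, Complex.exp_zero, mul_one] at h
  rw [← h, mul_assoc, ← Complex.exp_add, neg_add_cancel, Complex.exp_zero, mul_one]

/-- The vector of the plane as a complex number. -/
noncomputable def toComplex : ℝ × ℝ →L[ℝ] ℂ := Complex.equivRealProdCLM.symm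

/-- This identifies `pairKernel` with the imaginary part of the logarithmic derivative of the
complex difference. -/
theorem toComplex_im_div (d a : ℝ × ℝ) :
    (toComplex a / toComplex d).im = omegaForm d a / normSqPlane d := by
  rw [Complex.div_im]
  simp only [toComplex, ContinuousLinearEquiv.coe_coe, Complex.equivRealProdCLM_symm_apply_re,
    Complex.equivRealProdCLM_symm_apply_im, Complex.normSq_apply, omegaForm, normSqPlane]
  ring

theorem toComplex_ne_zero {d : ℝ × ℝ} (hd : d ≠ 0) : toComplex d ≠ 0 := by
  simpa [toComplex] using hd

/-- The total rotation of the difference of two points during the time interval `[0, T]`. -/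
noncomputable def pairRotation (X : ℝ → ℝ × ℝ → ℝ × ℝ) (g : ℝ → ℝ × ℝ → ℝ × ℝ) (T : ℝ)
    (z : (ℝ × ℝ) × (ℝ × ℝ)) : ℝ :=
  ∫ t in (0 : ℝ)..T, pairKernel (X t) (g t z.1) (g t z.2)

theorem normSqPlane_ne_zero {d : ℝ × ℝ} (hd : d ≠ 0) : normSqPlane d ≠ 0 :=
  (lt_of_lt_of_le (by have := norm_pos_iff.2 hd; positivity) (norm_sq_le_normSqPlane d)).ne'

theorem continuous_omegaForm : Continuous fun p : (ℝ × ℝ) × (ℝ × ℝ) => omegaForm p.1 p.2 := by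
  unfold omegaForm; fun_prop

namespace IsFlowOn

variable {D : Set (ℝ × ℝ)} {X Y : ℝ → ℝ × ℝ → ℝ × ℝ} {A B : ℝ → ℝ × ℝ → ℝ × ℝ →L[ℝ] ℝ × ℝ}
  {g k : ℝ → ℝ × ℝ → ℝ × ℝ}

theorem continuous_apply (hg : IsFlowOn D X g) {x : ℝ × ℝ} (hx : x ∈ D) :
    Continuous fun t => g t x :=
  continuous_iff_continuousAt.2 fun t => (hg.hasDerivAt x hx t).continuousAt

theorem continuous_field_apply (hg : IsFlowOn D X g) (hX : IsC1Field X A) {x : ℝ × ℝ}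
    (hx : x ∈ D) : Continuous fun t => X t (g t x) :=
  hX.continuous.comp (continuous_id.prodMk (hg.continuous_apply hx))

theorem sub_ne_zero (hg : IsFlowOn D X g) (hX : IsC1Field X A) {x y : ℝ × ℝ}
    (hx : x ∈ D) (hy : y ∈ D) (hxy : x ≠ y) (t : ℝ) : g t x - g t y ≠ 0 :=
  _root_.sub_ne_zero.2 fun h => hxy (hg.injOn hX t hx hy h)

theorem exists_pairRotation_eq (hg : IsFlowOn D X g) (hX : IsC1Field X A) {x y : ℝ × ℝ}
    (hx : x ∈ D) (hy : y ∈ D) (hxy : x ≠ y) (T : ℝ) :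
    ∃ W : ℂ, W.im = pairRotation X g T (x, y) ∧
      toComplex (g T x - g T y) = toComplex (x - y) * Complex.exp W := by
  have hder : ∀ t, HasDerivAt (fun t => toComplex (g t x - g t y))
      (toComplex (X t (g t x) - X t (g t y))) t := fun t =>
    toComplex.hasFDerivAt.comp_hasDerivAt t ((hg.hasDerivAt x hx t).sub (hg.hasDerivAt y hy t))
  have hc' : Continuous fun t => toComplex (X t (g t x) - X t (g t y)) :=
    toComplex.continuous.comp
      ((hg.continuous_field_apply hX hx).sub (hg.continuous_field_apply hX hy))
  have hc : Continuous fun t => toComplex (g t x - g t y) :=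
    toComplex.continuous.comp ((hg.continuous_apply hx).sub (hg.continuous_apply hy))
  have h0 : ∀ t, toComplex (g t x - g t y) ≠ 0 := fun t =>
    toComplex_ne_zero (hg.sub_ne_zero hX hx hy hxy t)
  have h := eq_mul_exp_integral hder hc' h0 T
  rw [hg.map_zero x hx, hg.map_zero y hy] at h
  refine ⟨_, ?_, h⟩
  have hI := Complex.imCLM.intervalIntegral_comp_comm 
    ((hc'.div hc h0).intervalIntegrable (μ := volume) 0 T)
  simp only [Complex.imCLM_apply] at hI
  refine hI.symm.trans ?_
  exact intervalIntegral.integral_congr fun t _ => toComplex_im_div _ _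

/-- Both exponentials carry the initial difference to the same final difference, so the exponents
differ by an integer multiple of `2πi`. -/
theorem exists_int_pairRotation_sub (hg : IsFlowOn D X g) (hX : IsC1Field X A)
    (hk : IsFlowOn D Y k) (hY : IsC1Field Y B) {T : ℝ} (hT : ∀ x ∈ D, g T x = k T x) {x y : ℝ × ℝ}
    (hx : x ∈ D) (hy : y ∈ D) (hxy : x ≠ y) :
    ∃ n : ℤ, (pairRotation X g T (x, y) - pairRotation Y k T (x, y)) / (2 * Real.pi) = n := by
  obtain ⟨W, hW, hWe⟩ := hg.exists_pairRotation_eq hX hx hy hxy T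
  obtain ⟨V, hV, hVe⟩ := hk.exists_pairRotation_eq hY hx hy hxy T
  rw [hT x hx, hT y hy, hVe] at hWe
  have hexp := mul_left_cancel₀ (toComplex_ne_zero (_root_.sub_ne_zero.2 hxy)) hWe
  obtain ⟨n, hn⟩ := Complex.exp_eq_exp_iff_exists_int.1 hexp.symm
  refine ⟨n, ?_⟩
  have him := congrArg Complex.im hn
  simp only [Complex.add_im, Complex.mul_im, Complex.intCast_re, Complex.intCast_im, zero_mul,
    add_zero, Complex.re_ofNat, Complex.ofReal_im, Complex.I_im, mul_one,
    Complex.mul_re, Complex.ofReal_re, Complex.im_ofNat, Complex.I_re, mul_zero, sub_zero] at him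
  rw [← hW, ← hV, him, div_eq_iff (by positivity)]
  ring

theorem exists_bound_pairKernel (hg : IsFlowOn D X g) (hX : IsC1Field X A) (hD : IsCompact D)
    (T : ℝ) : ∃ C : ℝ, ∀ t ∈ Icc 0 T, ∀ x ∈ D, ∀ y ∈ D,
      ‖pairKernel (X t) x y‖ ≤ C ∧ ‖pairKernel (X t) (g t x) (g t y)‖ ≤ C := by
  obtain ⟨R, hR⟩ := hD.isBounded.subset_closedBall 0
  obtain ⟨C, hC⟩ := hX.exists_lipschitzOnWith 0 T R
  have h : ∀ t ∈ Icc 0 T, ∀ x ∈ D, ∀ y ∈ D, ‖pairKernel (X t) x y‖ ≤ 2 * C :=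
    fun t ht x hx y hy => abs_pairKernel_le (by
      simpa [dist_eq_norm] using (hC t ht).dist_le_mul x (hR hx) y (hR hy))
  exact ⟨2 * C, fun t ht x hx y hy =>
    ⟨h t ht x hx y hy, h t ht _ (hg.mem hX hx t) _ (hg.mem hX hy t)⟩⟩

/-- Dominated convergence: the kernel is uniformly bounded, and off the diagonal it is continuous
because the flow keeps distinct points distinct. -/
theorem continuousOn_pairRotation (hg : IsFlowOn D X g) (hX : IsC1Field X A) (hD : IsCompact D)
    {T : ℝ} (hT : 0 ≤ T) :
    ContinuousOn (pairRotation X g T) {z | z.1 ∈ D ∧ z.2 ∈ D ∧ z.1 ≠ z.2} := by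
  obtain ⟨C, hC⟩ := hg.exists_bound_pairKernel hX hD T
  obtain ⟨L, hL⟩ := hg.exists_lipschitzOnWith hX hD T
  intro z₀ hz₀
  refine intervalIntegral.continuousWithinAt_of_dominated_interval (bound := fun _ => C) ?_ ?_
    intervalIntegrable_const ?_
  · filter_upwards [self_mem_nhdsWithin] with z hz
    have h1 := (hg.continuous_apply hz.1).sub (hg.continuous_apply hz.2.1)
    have h2 := (hg.continuous_field_apply hX hz.1).sub (hg.continuous_field_apply hX hz.2.1)
    exact ((continuous_omegaForm.comp (h1.prodMk h2)).div (continuous_normSqPlane.comp h1)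
      fun t => normSqPlane_ne_zero (hg.sub_ne_zero hX hz.1 hz.2.1 hz.2.2 t)).aestronglyMeasurable
  · filter_upwards [self_mem_nhdsWithin] with z hz
    refine ae_of_all _ fun t ht => ?_
    rw [uIoc_of_le hT] at ht
    exact (hC t (Ioc_subset_Icc_self ht) _ hz.1 _ hz.2.1).2
  · refine ae_of_all _ fun t ht => ?_
    rw [uIoc_of_le hT] at ht
    have hgt := (hL t (Ioc_subset_Icc_self ht)).continuousOn
    have hXt : Continuous (X t) := hX.continuous.comp (Continuous.prodMk_right t)
    have hg1 : ContinuousOn (fun z : (ℝ × ℝ) × (ℝ × ℝ) => g t z.1)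
        {z | z.1 ∈ D ∧ z.2 ∈ D ∧ z.1 ≠ z.2} := hgt.comp continuousOn_fst fun z hz => hz.1
    have hg2 : ContinuousOn (fun z : (ℝ × ℝ) × (ℝ × ℝ) => g t z.2)
        {z | z.1 ∈ D ∧ z.2 ∈ D ∧ z.1 ≠ z.2} := hgt.comp continuousOn_snd fun z hz => hz.2.1
    exact ((continuous_omegaForm.comp_continuousOn ((hg1.sub hg2).prodMk
      ((hXt.comp_continuousOn hg1).sub (hXt.comp_continuousOn hg2)))).div
      (continuous_normSqPlane.comp_continuousOn (hg1.sub hg2))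
      fun z hz => normSqPlane_ne_zero (hg.sub_ne_zero hX hz.1 hz.2.1 hz.2.2 t)) z₀ hz₀

theorem integrable_pairKernel_comp (hD : IsCompact D) {Z φ : ℝ × ℝ → ℝ × ℝ} (hZ : Continuous Z)
    (hφ : ContinuousOn φ D) {C : ℝ}
    (hC : ∀ x ∈ D, ∀ y ∈ D, ‖pairKernel Z (φ x) (φ y)‖ ≤ C) :
    Integrable (fun z : (ℝ × ℝ) × (ℝ × ℝ) => pairKernel Z (φ z.1) (φ z.2))
      ((volume.restrict D).prod (volume.restrict D)) := by
  have hDm := hD.measurableSet.prod hD.measurableSet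
  have h1 : ContinuousOn (fun z : (ℝ × ℝ) × (ℝ × ℝ) => φ z.1) (D ×ˢ D) :=
    hφ.comp continuousOn_fst fun z hz => hz.1
  have h2 : ContinuousOn (fun z : (ℝ × ℝ) × (ℝ × ℝ) => φ z.2) (D ×ˢ D) :=
    hφ.comp continuousOn_snd fun z hz => hz.2
  have hfin : IsFiniteMeasure (volume.restrict D) := ⟨by simpa using hD.measure_lt_top⟩
  have hnum := (continuous_omegaForm.comp_continuousOn ((h1.sub h2).prodMk
    ((hZ.comp_continuousOn h1).sub (hZ.comp_continuousOn h2)))).aemeasurable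
      (μ := volume.prod volume) hDm
  have hden := (continuous_normSqPlane.comp_continuousOn (h1.sub h2)).aemeasurable
    (μ := volume.prod volume) hDm
  rw [← Measure.prod_restrict] at hnum hden
  refine Integrable.of_bound (C := C) (hnum.div hden).aestronglyMeasurable ?_
  rw [Measure.prod_restrict]
  filter_upwards [ae_restrict_mem hDm] with z hz using hC _ hz.1 _ hz.2

/-- Fubini, then Liouville's theorem in each variable in turn. -/
theorem integral_pairKernel_comp (hg : IsFlowOn D X g) (hX : IsC1Field X A) (hD : IsCompact D)
    (hA : ∀ t x u v, omegaForm (A t x u) v + omegaForm u (A t x v) = 0) {t : ℝ} (ht : 0 ≤ t) :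
    ∫ z, pairKernel (X t) (g t z.1) (g t z.2) ∂((volume.restrict D).prod (volume.restrict D)) =
      ∫ z, pairKernel (X t) z.1 z.2 ∂((volume.restrict D).prod (volume.restrict D)) := by
  obtain ⟨C, hC⟩ := hg.exists_bound_pairKernel hX hD t
  obtain ⟨L, hL⟩ := hg.exists_lipschitzOnWith hX hD t
  have ht' := right_mem_Icc.2 ht
  have hXt : Continuous (X t) := hX.continuous.comp (Continuous.prodMk_right t)
  have hid : Integrable (fun z : (ℝ × ℝ) × (ℝ × ℝ) => pairKernel (X t) z.1 z.2)
      ((volume.restrict D).prod (volume.restrict D)) :=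
    integrable_pairKernel_comp (φ := id) hD hXt continuousOn_id
      fun x hx y hy => (hC t ht' x hx y hy).1
  rw [integral_prod _ (integrable_pairKernel_comp hD hXt (hL t ht').continuousOn
      fun x hx y hy => (hC t ht' x hx y hy).2),
    integral_prod _ hid]
  have h1 : ∀ x, ∫ y in D, pairKernel (X t) (g t x) (g t y) =
      ∫ y in D, pairKernel (X t) (g t x) y := fun x => hg.setIntegral_comp hX hD hA ht _
  simp only [h1]
  exact hg.setIntegral_comp hX hD hA ht fun x => ∫ y in D, pairKernel (X t) x y

theorem integral_pairRotation (hg : IsFlowOn D X g) (hX : IsC1Field X A) (hD : IsCompact D)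
    (hA : ∀ t x u v, omegaForm (A t x u) v + omegaForm u (A t x v) = 0) {T : ℝ} (hT : 0 ≤ T) :
    Integrable (pairRotation X g T) ((volume.restrict D).prod (volume.restrict D)) ∧
    ∫ z, pairRotation X g T z ∂((volume.restrict D).prod (volume.restrict D)) =
      ∫ t in (0 : ℝ)..T, ∫ z, pairKernel (X t) z.1 z.2
        ∂((volume.restrict D).prod (volume.restrict D)) := by
  obtain ⟨C, hC⟩ := hg.exists_bound_pairKernel hX hD T
  set ν := (volume.restrict D).prod (volume.restrict D) with hν
  have hν' : ν = (volume.prod volume).restrict (D ×ˢ D) := Measure.prod_restrict _ _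
  have hfin : IsFiniteMeasure (volume.restrict D) := ⟨by simpa using hD.measure_lt_top⟩
  have hSm : MeasurableSet (Icc 0 T ×ˢ (D ×ˢ D)) :=
    measurableSet_Icc.prod (hD.measurableSet.prod hD.measurableSet)
  have hμ : ((volume : Measure ℝ).restrict (Ioc 0 T)).prod ν =
      ((volume : Measure ℝ).prod (volume.prod volume)).restrict (Icc 0 T ×ˢ (D ×ˢ D)) := by
    rw [restrict_Ioc_eq_restrict_Icc, hν', Measure.prod_restrict]
  have hflow := hg.continuousOn hX hD T
  have h1 : ContinuousOn (fun p : ℝ × ((ℝ × ℝ) × (ℝ × ℝ)) => g p.1 p.2.1)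
      (Icc 0 T ×ˢ (D ×ˢ D)) :=
    hflow.comp (f := fun p : ℝ × ((ℝ × ℝ) × (ℝ × ℝ)) => (p.1, p.2.1)) (by fun_prop)
      fun p hp => ⟨hp.1, hp.2.1⟩
  have h2 : ContinuousOn (fun p : ℝ × ((ℝ × ℝ) × (ℝ × ℝ)) => g p.1 p.2.2)
      (Icc 0 T ×ˢ (D ×ˢ D)) :=
    hflow.comp (f := fun p : ℝ × ((ℝ × ℝ) × (ℝ × ℝ)) => (p.1, p.2.2)) (by fun_prop)
      fun p hp => ⟨hp.1, hp.2.2⟩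
  have hi : Integrable (fun p : ℝ × ((ℝ × ℝ) × (ℝ × ℝ)) =>
      pairKernel (X p.1) (g p.1 p.2.1) (g p.1 p.2.2)) ((volume.restrict (Ioc 0 T)).prod ν) := by
    refine Integrable.of_bound (C := C) ?_ ?_
    · rw [hμ]
      have hX1 := hX.continuous.comp_continuousOn (continuousOn_fst.prodMk h1)
      have hX2 := hX.continuous.comp_continuousOn (continuousOn_fst.prodMk h2)
      exact (((continuous_omegaForm.comp_continuousOn ((h1.sub h2).prodMk
        (hX1.sub hX2))).aemeasurable hSm).div ((continuous_normSqPlane.comp_continuousOn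
          (h1.sub h2)).aemeasurable hSm)).aestronglyMeasurable
    · rw [hμ]
      filter_upwards [ae_restrict_mem hSm] with p hp using (hC _ hp.1 _ hp.2.1 _ hp.2.2).2
  have hrot : pairRotation X g T = fun z => ∫ t in Ioc 0 T, pairKernel (X t) (g t z.1) (g t z.2) := by
    ext z
    exact intervalIntegral.integral_of_le hT
  rw [hrot]
  refine ⟨hi.integral_prod_right, ?_⟩
  rw [← integral_integral_swap hi, intervalIntegral.integral_of_le hT]
  exact setIntegral_congr_fun measurableSet_Ioc fun t ht =>
    hg.integral_pairKernel_comp hX hD hA ht.1.le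

end IsFlowOn

/-! ### Hamiltonians, helicity and the conclusion -/

theorem omegaForm_swap (u v : ℝ × ℝ) : omegaForm u v = -omegaForm v u := by
  simp only [omegaForm]; ring

namespace IsPeriodicHamiltonian

variable {H : ℝ → ℝ × ℝ → ℝ}

theorem isC1Field (hH : IsPeriodicHamiltonian H) :
    IsC1Field (hamVectorField H) fun t x => symplDual ∘L fderiv ℝ (fderiv ℝ (H t)) x where
  hasFDerivAt t x := by
    have h1 : Differentiable ℝ (fderiv ℝ (H t)) :=
      ((hH.contDiff t).fderiv_right (m := 1) (by norm_num)).differentiable one_ne_zero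
    exact symplDual.hasFDerivAt.comp x (h1 x).hasFDerivAt
  continuous := symplDual.continuous.comp hH.continuous_fderiv
  continuous_fderiv := continuous_const.clm_comp hH.continuous_fderiv_fderiv

/-- Symmetry of the second derivative of `H t` makes the linearised field infinitesimally
symplectic. -/
theorem omegaForm_fderiv_add (hH : IsPeriodicHamiltonian H) (t : ℝ) (x u v : ℝ × ℝ) :
    omegaForm ((symplDual ∘L fderiv ℝ (fderiv ℝ (H t)) x) u) v +
      omegaForm u ((symplDual ∘L fderiv ℝ (fderiv ℝ (H t)) x) v) = 0 := by
  have hsymm : IsSymmSndFDerivAt ℝ (H t) x :=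
    (hH.contDiff t).contDiffAt.isSymmSndFDerivAt (by simp)
  rw [omegaForm_swap, ContinuousLinearMap.comp_apply, ContinuousLinearMap.comp_apply,
    omegaForm_symplDual, omegaForm_symplDual, hsymm.eq u v]
  ring

end IsPeriodicHamiltonian

theorem IsInvariantSet.isFlowOn {D : Set (ℝ × ℝ)} {H : ℝ → ℝ × ℝ → ℝ} {g : ℝ → ℝ × ℝ → ℝ × ℝ}
    (hinv : IsInvariantSet D H) (hg : IsHamFlow D H g) : IsFlowOn D (hamVectorField H) g :=
  ⟨hinv, fun x hx => (hg x hx).1, fun x hx => (hg x hx).2⟩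

/-- A Hamiltonian that is constant on the nonempty frontier at all times has a unique
normalisation. -/
theorem existsUnique_isNormalisation {D : Set (ℝ × ℝ)} {H : ℝ → ℝ × ℝ → ℝ}
    (hne : (frontier D).Nonempty)
    (hconst : ∀ t, ∀ x ∈ frontier D, ∀ y ∈ frontier D, H t x = H t y) :
    ∃! K : ℝ → ℝ × ℝ → ℝ, IsNormalisation D H K := by
  obtain ⟨x₀, hx₀⟩ := hne
  refine ⟨fun t x => H t x - H t x₀, ⟨⟨fun t => -H t x₀, fun t x => sub_eq_add_neg _ _⟩,
    fun t x hx => sub_eq_zero.2 (hconst t x hx x₀ hx₀)⟩, ?_⟩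
  rintro K ⟨⟨c, hc⟩, h0⟩
  ext t x
  have h1 := h0 t x₀ hx₀
  rw [hc] at h1
  rw [hc]
  linarith

/-- The total rotation of all pairs of points of `D` is `-4π` times the helicity. -/
theorem integral_pairRotation_eq_helicityIntegral {D : Set (ℝ × ℝ)} {H K : ℝ → ℝ × ℝ → ℝ}
    {g : ℝ → ℝ × ℝ → ℝ × ℝ} (hD : IsCompact D) (hfr : volume (frontier D) = 0)
    (hH : IsPeriodicHamiltonian H) (hg : IsFlowOn D (hamVectorField H) g)
    (hK : IsNormalisation D H K) :
    Integrable (pairRotation (hamVectorField H) g (2 * Real.pi))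
      ((volume.restrict D).prod (volume.restrict D)) ∧
    ∫ z, pairRotation (hamVectorField H) g (2 * Real.pi) z
      ∂((volume.restrict D).prod (volume.restrict D)) =
      -(4 * Real.pi) * helicityIntegral D K := by
  obtain ⟨hi, hv⟩ := hg.integral_pairRotation hH.isC1Field hD hH.omegaForm_fderiv_add
    Real.two_pi_pos.le
  refine ⟨hi, hv.trans ?_⟩
  obtain ⟨⟨c, hc⟩, h0⟩ := hK
  rw [helicityIntegral, ← intervalIntegral.integral_const_mul]
  refine intervalIntegral.integral_congr fun t _ => ?_
  have hKt : K t = fun x => H t x + c t := funext (hc t)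
  have hKd : ContDiff ℝ 1 (K t) := by
    rw [hKt]
    exact ((hH.contDiff t).of_le one_le_two).add contDiff_const
  have hfield : hamVectorField H t = symplGradient (K t) := by
    ext x <;> simp [hamVectorField, symplGradient, symplDual, hKt]
  simp only [hfield]
  exact integral_pairKernel hD hfr hKd (h0 t)

theorem ae_fst_ne_snd {D : Set (ℝ × ℝ)} :
    ∀ᵐ z ∂((volume.restrict D).prod (volume.restrict D)), z.1 ≠ z.2 := by
  have hm : MeasurableSet {z : (ℝ × ℝ) × (ℝ × ℝ) | z.1 ≠ z.2} :=
    (isClosed_eq continuous_fst continuous_snd).measurableSet.compl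
  rw [Measure.ae_prod_iff_ae_ae hm]
  refine ae_of_all _ fun x => ?_
  filter_upwards [compl_mem_ae_iff.2 (measure_singleton (μ := volume.restrict D) x)] with y hy
  exact fun h => hy h.symm

theorem theorem1 (D : Set (ℝ × ℝ)) (hD : IsDisk D)
    (h : ℝ × ℝ → ℝ × ℝ) (hh : IsSymplecticMap D h)
    (hbd : MapsTo h (frontier D) (frontier D))
    (H₁ H₂ : ℝ → ℝ × ℝ → ℝ)
    (hH₁ : IsPeriodicHamiltonian H₁) (hH₂ : IsPeriodicHamiltonian H₂)
    (hinv₁ : IsInvariantSet D H₁) (hinv₂ : IsInvariantSet D H₂)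
    (g₁ g₂ : ℝ → ℝ × ℝ → ℝ × ℝ)
    (hg₁ : IsHamFlow D H₁ g₁) (hg₂ : IsHamFlow D H₂ g₂)
    (hmap₁ : ∀ x ∈ D, g₁ (2 * Real.pi) x = h x)
    (hmap₂ : ∀ x ∈ D, g₂ (2 * Real.pi) x = h x) :
    (∃! K₁ : ℝ → ℝ × ℝ → ℝ, IsNormalisation D H₁ K₁) ∧
    (∃! K₂ : ℝ → ℝ × ℝ → ℝ, IsNormalisation D H₂ K₂) ∧
    ∀ K₁ K₂ : ℝ → ℝ × ℝ → ℝ, IsNormalisation D H₁ K₁ → IsNormalisation D H₂ K₂ →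
      ∃ n : ℤ, helicityIntegral D K₁ - helicityIntegral D K₂
        = (n : ℝ) * symplecticArea D ^ 2 / 2 := by
  obtain ⟨Φ, hs, hΦ, hΦs, rfl⟩ := hD
  set D := Φ '' closedUnitDisk with hDdef
  have hDc : IsCompact D := isCompact_image_closedUnitDisk hs
  have hfr := frontier_image_closedUnitDisk_subset hs
  have hfr0 : volume (frontier D) = 0 := measure_mono_null hfr (volume_image_unitCircle hs hΦ)
  have hconst : ∀ H : ℝ → ℝ × ℝ → ℝ, IsPeriodicHamiltonian H → IsInvariantSet D H →
      ∀ t, ∀ x ∈ frontier D, ∀ y ∈ frontier D, H t x = H t y := by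
    intro H hH hinv t x hx y hy
    refine eq_on_image_unitCircle hs hΦ hΦs ((hH.contDiff t).differentiable two_ne_zero)
      (t := t) (fun z hz => ?_) (hfr hx) (hfr hy)
    obtain ⟨γ, hγ, hγt, hγD⟩ := hinv t z hz
    exact ⟨γ, hγt ▸ hγ t, hγt, hγD⟩
  have hne := frontier_image_closedUnitDisk_nonempty hs
  refine ⟨existsUnique_isNormalisation hne (hconst H₁ hH₁ hinv₁),
    existsUnique_isNormalisation hne (hconst H₂ hH₂ hinv₂), fun K₁ K₂ hK₁ hK₂ => ?_⟩
  have hF₁ := hinv₁.isFlowOn hg₁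
  have hF₂ := hinv₂.isFlowOn hg₂
  obtain ⟨hi₁, hv₁⟩ := integral_pairRotation_eq_helicityIntegral hDc hfr0 hH₁ hF₁ hK₁
  obtain ⟨hi₂, hv₂⟩ := integral_pairRotation_eq_helicityIntegral hDc hfr0 hH₂ hF₂ hK₂
  obtain ⟨n, hn⟩ := exists_int_eq_of_continuousOn hs
    (f := fun z => (pairRotation (hamVectorField H₁) g₁ (2 * Real.pi) z -
      pairRotation (hamVectorField H₂) g₂ (2 * Real.pi) z) / (2 * Real.pi))
    (((hF₁.continuousOn_pairRotation hH₁.isC1Field hDc Real.two_pi_pos.le).sub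
      (hF₂.continuousOn_pairRotation hH₂.isC1Field hDc Real.two_pi_pos.le)).div_const _)
    (fun x hx y hy hxy => hF₁.exists_int_pairRotation_sub hH₁.isC1Field hF₂ hH₂.isC1Field
      (fun x hx => (hmap₁ x hx).trans (hmap₂ x hx).symm) hx hy hxy)
  have hcircle : ∀ᵐ x ∂(volume.restrict D), x ∈ Φ '' openUnitDisk := by
    have h0 : ∀ᵐ x, x ∉ Φ '' {x | normSqPlane x = 1} := by
      exact compl_mem_ae_iff.2 (volume_image_unitCircle hs hΦ)
    filter_upwards [ae_restrict_mem hDc.measurableSet, ae_restrict_of_ae h0]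
    rintro _ ⟨u, hu, rfl⟩ hnot
    exact ⟨u, lt_of_le_of_ne hu fun h => hnot ⟨u, h, rfl⟩, rfl⟩
  have hae : (fun z => pairRotation (hamVectorField H₁) g₁ (2 * Real.pi) z -
      pairRotation (hamVectorField H₂) g₂ (2 * Real.pi) z)
      =ᵐ[(volume.restrict D).prod (volume.restrict D)] fun _ => n * (2 * Real.pi) := by
    filter_upwards [ae_fst_ne_snd, Measure.quasiMeasurePreserving_fst.ae hcircle,
      Measure.quasiMeasurePreserving_snd.ae hcircle] with z hz h1 h2
    have := hn z.1 h1 z.2 h2 hz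
    rwa [div_eq_iff (by positivity)] at this
  have hint := integral_congr_ae hae
  rw [integral_sub hi₁ hi₂, hv₁, hv₂, integral_const, Measure.prod_restrict, 
    measureReal_restrict_apply_univ, measureReal_prod_prod] at hint
  -- The sign comes from the factor `-4π` between integrated rotation and helicity.
  refine ⟨-n, ?_⟩
  have hpi := Real.pi_pos
  have hS : symplecticArea D = volume.real D := rfl
  rw [hS]
  simp only [smul_eq_mul] at hint
  have : (4 * Real.pi) * (helicityIntegral D K₁ - helicityIntegral D K₂) =
      (4 * Real.pi) * (((-n : ℤ) : ℝ) * volume.real D ^ 2 / 2) := by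
    push_cast
    linear_combination -hint
  exact mul_left_cancel₀ (by positivity) this
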